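/- Consider two particles with masses $\mu_1,\mu_2>0$ on the Lobachevsky plane $L^2=\{R=(X,Y,Z)\in\mathbb{R}^3: X^2+Y^2-Z^2=-1,\ Z>0\}$ with the metric induced by $\langle x,y\rangle_K=(x,Ky)$, $K=\mathrm{diag}(1,1,-1)$, interacting through the gravitational potential $U(q)=-G\mu_1\mu_2/\tanh q$, $G>0$, where $q>0$ is the Riemannian distance between them. Put $\mu=\mu_1/\mu_2$. Modulo the symmetry group $SO(2,1)$ the motion is governed by the reduced system on $\mathbb{R}^3\times(0,\infty)\times\mathbb{R}\ni(m,q,p)$, $$\dot m=(Km)\times\frac{\partial H}{\partial m},\qquad \dot q=\frac{\partial H}{\partial p},\qquad \dot p=-\frac{\partial H}{\partial q},$$ $$H(m,q,p)=\frac1{2\mu_1}\Bigl((m,A(q)m)-2m_xp+(1+\mu)p^2\Bigr)+U(q),\qquad A(q)=\begin{pmatrix}1&0&0\\0&1&-\coth q\\0&-\coth q&\dfrac{\mu+\cosh^2q}{\sinh^2q}\end{pmatrix}.$$ Here $m$ is the angular momentum in the moving frame $g\in SO(2,1)$ in which the particles have coordinates $(0,0,1)$ and $(0,\sinh q,\cosh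 q)$, and $p$ is the momentum conjugate to $q$. The function $C(m)=-\langle m,m\rangle_K$ is a first integral. A relative equilibrium is a motion of the two particles that coincides with the action of a nontrivial one-parameter subgroup of $SO(2,1)$; it is called elliptic (hyperbolic) if this subgroup fixes a timelike (spacelike) vector, i.e. consists of rotations about a point of $L^2$ (of translations along a geodesic). Its reduced state $(m,q,p)$ is an equilibrium of the reduced system, and the stability of the relative equilibrium is by definition that of this equilibrium. It is called nonlinearly stable if it is stable in the sense of Lyapunov, and linearly unstable if the linearized reduced system has an eigenvalue with positive real part. Then: 1. All hyperbolic relative equilibria are linearly unstable; they are also unstable in the sense of Lyapunov, even with respect to perturbations of the reduced initial state that preserve the value of $C$. 2. The equation $$2\sinh^2\alpha+1=2\sinh^2\alpha\,\sqrt{1+\mu^2\sinh^2 2\alpha}$$ has a unique positive solution $\alpha^*$. Put $q^*=\alpha^*+\tfrac12\operatorname{arcsinh}(\mu\sinh2\alpha^*)$. Then $q^*>0$, and an elliptic relative equilibrium in which the particles are at distance $q$ is nonlinearly stable if $q<q^*$, and unstable if $q>q^*$: it is then linearly unstable, and unstable in the sense of Lyapunov, even with respect to perturbations of the reduced initial state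 that preserve the value of $C$. -/

import Mathlib

open scoped Matrix

noncomputable section

namespace LobachevskyTwoBody

/-! ### Minkowski space and the Lobachevsky plane -/

/-- Vectors of the three-dimensional Minkowski space. -/
abbrev Vec := Fin 3 → ℝ

/-- The matrix `K = diag(1, 1, -1)`. -/
def K : Matrix (Fin 3) (Fin 3) ℝ := Matrix.diagonal ![1, 1, -1]

/-- The Minkowski scalar product `⟨x, y⟩_K = (x, K y)`. -/
def mink (x y : Vec) : ℝ := x ⬝ᵥ (K *ᵥ y)

/-- The Lobachevsky plane: the upper sheet of the hyperboloid `X² + Y² - Z² = -1`. -/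
def plane : Set Vec := {R | mink R R = -1 ∧ 0 < R 2}

/-- The Riemannian distance of two points of the Lobachevsky plane: `cosh d = -⟨x, y⟩_K`. -/
def hdist (x y : Vec) : ℝ := Real.arcosh (-mink x y)

/-! ### The two-body problem -/

/-- The gravitational potential on the Lobachevsky plane. -/
def gravPotential (G μ₁ μ₂ : ℝ) (q : ℝ) : ℝ := -(G * μ₁ * μ₂) / Real.tanh q

/-- `t ↦ (R₁ t, R₂ t)` is a collision-free motion of the two-body problem on the Lobachevsky plane
with masses `μ₁`, `μ₂` and potential energy `U (hdist R₁ R₂)`. The equation of motion says that for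
each particle, mass times covariant acceleration (the tangential part of the second derivative) is
minus the Riemannian gradient of the potential energy with respect to its position; it is tested
against all vectors `w` that are tangent to the plane at that position. -/
structure IsMotion (μ₁ μ₂ : ℝ) (U : ℝ → ℝ) (R₁ R₂ : ℝ → Vec) : Prop where
  smooth₁ : ContDiff ℝ 2 R₁
  smooth₂ : ContDiff ℝ 2 R₂
  mem₁ : ∀ t, R₁ t ∈ plane
  mem₂ : ∀ t, R₂ t ∈ plane
  noCollision : ∀ t, R₁ t ≠ R₂ t
  newton₁ : ∀ t w, mink (R₁ t) w = 0 →
    μ₁ * mink (deriv (deriv R₁) t) w = -(fderiv ℝ (fun x => U (hdist x (R₂ t))) (R₁ t) w)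
  newton₂ : ∀ t w, mink (R₂ t) w = 0 →
    μ₂ * mink (deriv (deriv R₂) t) w = -(fderiv ℝ (fun x => U (hdist (R₁ t) x)) (R₂ t) w)

/-- `ξ` belongs to the Lie algebra `so(2,1)`. -/
def IsGenerator (ξ : Matrix (Fin 3) (Fin 3) ℝ) : Prop := ξᵀ * K + K * ξ = 0

/-- A relative equilibrium: a motion that coincides with the action of the one-parameter subgroup
`t ↦ exp (t ξ)` of `SO(2,1)` on both particles. -/
def IsRelativeEquilibrium (μ₁ μ₂ : ℝ) (U : ℝ → ℝ) (ξ : Matrix (Fin 3) (Fin 3) ℝ)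
    (R₁ R₂ : ℝ → Vec) : Prop :=
  IsMotion μ₁ μ₂ U R₁ R₂ ∧ IsGenerator ξ ∧
    ∀ t, R₁ t = NormedSpace.exp (t • ξ) *ᵥ R₁ 0 ∧ R₂ t = NormedSpace.exp (t • ξ) *ᵥ R₂ 0

/-- `ξ` generates an elliptic one-parameter subgroup: a nontrivial one that fixes a timelike vector,
so that it consists of the rotations about a point of the Lobachevsky plane. -/
def IsElliptic (ξ : Matrix (Fin 3) (Fin 3) ℝ) : Prop :=
  IsGenerator ξ ∧ ξ ≠ 0 ∧ ∃ n : Vec, mink n n < 0 ∧ ξ *ᵥ n = 0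

/-- `ξ` generates a hyperbolic one-parameter subgroup: a nontrivial one that fixes a spacelike
vector, so that it consists of the translations along a geodesic of the Lobachevsky plane. -/
def IsHyperbolic (ξ : Matrix (Fin 3) (Fin 3) ℝ) : Prop :=
  IsGenerator ξ ∧ ξ ≠ 0 ∧ ∃ n : Vec, 0 < mink n n ∧ ξ *ᵥ n = 0

/-! ### The reduced system -/

/-- The vector space with coordinates `(m, q, p)`. -/
abbrev RedVec := Vec × ℝ × ℝ

/-- The reduced phase space `ℝ³ × (0, ∞) × ℝ`. -/
def redSpace : Set RedVec := {z | 0 < z.2.1}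

/-- The matrix `A(q)` of the reduced kinetic energy, for the mass ratio `μ`. -/
def inertia (μ q : ℝ) : Matrix (Fin 3) (Fin 3) ℝ :=
  !![1, 0, 0;
     0, 1, -(Real.cosh q / Real.sinh q);
     0, -(Real.cosh q / Real.sinh q), (μ + Real.cosh q ^ 2) / Real.sinh q ^ 2]

/-- The reduced Hamiltonian. -/
def hamiltonian (μ₁ μ₂ : ℝ) (U : ℝ → ℝ) (m : Vec) (q p : ℝ) : ℝ :=
  1 / (2 * μ₁) * (m ⬝ᵥ (inertia (μ₁ / μ₂) q *ᵥ m) - 2 * m 0 * p + (1 + μ₁ / μ₂) * p ^ 2) + U q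

/-- The reduced equations of motion
`m' = (K m) × ∂H/∂m`, `q' = ∂H/∂p`, `p' = -∂H/∂q`. -/
def redField (μ₁ μ₂ : ℝ) (U : ℝ → ℝ) (z : RedVec) : RedVec :=
  ((K *ᵥ z.1) ⨯₃
      (fun i => fderiv ℝ (fun m => hamiltonian μ₁ μ₂ U m z.2.1 z.2.2) z.1 (Pi.single i 1)),
    deriv (fun p => hamiltonian μ₁ μ₂ U z.1 z.2.1 p) z.2.2,
    -deriv (fun q => hamiltonian μ₁ μ₂ U z.1 q z.2.2) z.2.1)

/-- The Casimir function `C = -⟨m, m⟩_K`; its regular level sets are the symplectic leaves. -/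
def casimir (z : RedVec) : ℝ := -mink z.1 z.1

/-- The angular momentum in the fixed frame, of particles at `x₁`, `x₂` with velocities
`v₁`, `v₂`. -/
def angularMomentum (μ₁ μ₂ : ℝ) (x₁ x₂ v₁ v₂ : Vec) : Vec :=
  μ₁ • ((K *ᵥ x₁) ⨯₃ (K *ᵥ v₁)) + μ₂ • ((K *ᵥ x₂) ⨯₃ (K *ᵥ v₂))

/-- `z = (m, q, p)` is the point of the reduced space that belongs to the particles at `x₁`, `x₂`
with velocities `v₁`, `v₂`. The moving frame `g ∈ SO(2,1)` is the one in which the particles have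
the coordinates `(0, 0, 1)` and `(0, sinh q, cosh q)`; `m` is the angular momentum in the moving
frame, and `p` is the momentum conjugate to `q`, that is, the scalar product of `μ₂ v₂` with the
derivative of `x₂ = g (0, sinh q, cosh q)` with respect to `q`. -/
def IsReducedState (μ₁ μ₂ : ℝ) (x₁ x₂ v₁ v₂ : Vec) (z : RedVec) : Prop :=
  z ∈ redSpace ∧ ∃ g : Matrix (Fin 3) (Fin 3) ℝ, gᵀ * K * g = K ∧ g.det = 1 ∧
    x₁ = g *ᵥ ![0, 0, 1] ∧
    x₂ = g *ᵥ ![0, Real.sinh z.2.1, Real.cosh z.2.1] ∧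
    angularMomentum μ₁ μ₂ x₁ x₂ v₁ v₂ = g *ᵥ z.1 ∧
    z.2.2 = μ₂ * mink v₂ (g *ᵥ ![0, Real.cosh z.2.1, Real.sinh z.2.1])

/-! ### Stability -/

section Stability

variable {E : Type*} [NormedAddCommGroup E] [NormedSpace ℝ E]

/-- `γ` solves `z' = X z` on the time interval `s`, inside the phase space `D`. -/
def IsSolutionOn (X : E → E) (D : Set E) (γ : ℝ → E) (s : Set ℝ) : Prop :=
  ∀ t ∈ s, γ t ∈ D ∧ HasDerivWithinAt γ (X (γ t)) s t

/-- `z₀` is a (nonlinearly, Lyapunov) stable equilibrium of `z' = X z` on the phase space `D`: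
a solution that starts near `z₀` exists for all positive times and stays near `z₀`. -/
def IsLyapunovStable (X : E → E) (D : Set E) (z₀ : E) : Prop :=
  z₀ ∈ D ∧ X z₀ = 0 ∧ ∀ ε > 0, ∃ δ > 0, ∀ z ∈ D, dist z z₀ < δ →
    (∃ γ : ℝ → E, γ 0 = z ∧ IsSolutionOn X D γ (Set.Ici 0)) ∧
    ∀ (γ : ℝ → E) (T : ℝ), 0 ≤ T → γ 0 = z → IsSolutionOn X D γ (Set.Icc 0 T) →
      ∀ t ∈ Set.Icc 0 T, dist (γ t) z₀ < ε

/-- `z₀` is an equilibrium of `z' = X z` on the phase space `D` that is not Lyapunov stable, even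
with respect to perturbations in `S` of the initial state: there are solutions starting in `S`,
arbitrarily near `z₀`, that leave a fixed neighbourhood of `z₀`. -/
def IsLyapunovUnstableWithin (X : E → E) (D S : Set E) (z₀ : E) : Prop :=
  z₀ ∈ D ∧ X z₀ = 0 ∧ ∃ ε > 0, ∀ δ > 0, ∃ (γ : ℝ → E) (T : ℝ), 0 ≤ T ∧
    IsSolutionOn X D γ (Set.Icc 0 T) ∧ γ 0 ∈ S ∧ dist (γ 0) z₀ < δ ∧ ε ≤ dist (γ T) z₀

/-- `z₀` is a linearly unstable equilibrium of `z' = X z` on the phase space `D`: the linearization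
has an eigenvalue with positive real part. -/
def IsLinearlyUnstable (X : E → E) (D : Set E) (z₀ : E) : Prop :=
  z₀ ∈ D ∧ X z₀ = 0 ∧ ∃ l : ℂ, 0 < l.re ∧
    Module.End.HasEigenvalue
      (LinearMap.baseChange ℂ (fderiv ℝ X z₀ : E →ₗ[ℝ] E) : Module.End ℂ (TensorProduct ℝ ℂ E)) l

end Stability

end LobachevskyTwoBody

end

open LobachevskyTwoBody

noncomputable section

namespace LobachevskyTwoBody

/-! ### Lyapunov's and Chetaev's criteria for `C¹` vector fields -/

section ODE

open Set Metric Filter Topology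

variable {E : Type*} [NormedAddCommGroup E] [NormedSpace ℝ E]

/-! With `M = 1 + μ₁/μ₂` and `c = coth q`, the Hamiltonian and the reduced field become polynomial.
In the moving frame, the Newton equations force a relative equilibrium to have `p = 0` and `m = (0,
r Z, Z)`, parallel to the vector fixed by the subgroup; hence `r < 1` in the elliptic and `r > 1` in
the hyperbolic case. Two scalar equations remain (`IsEquilibriumData`).

The energy plus a multiple of the Casimir function is critical at the equilibrium. Its quadratic
part (`aug_eq`) splits into a block `T` in the odd variables `(x, p)`, a block `S` in the even
variables `(u, e)`, and a coupling to the linearized Casimir function `l`. Modulo `l`, and up to the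
factor `1/μ₁`, the linearized system is `(u, e)' = -T (x, p)`, `(x, p)' = S (u, e)`. Since `T` is
positive definite and `S₁₁ > 0`, the sign of `det S` decides.

If `det S > 0`, the energy-Casimir function plus a multiple of the squared Casimir deviation is an
integral with a strict local minimum, so the equilibrium is stable. If `det S < 0`, there are `l >
0` and vectors `a`, `b` with `T a = -l b`, `S b = l a` (`exists_hyperbolic_mode`). They give an
eigenvector of the linearization and the linear functions `φ = a·(u, e)`, `ψ = b·(x, p)` with `φ' ≈
l ψ`, `ψ' ≈ l φ`. On the invariant set of the same Casimir value and nonpositive relative energy,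
`φ` dominates the whole deviation (`coercive` with `κ > 0`), so the nonlinear terms are negligible
and `φ ψ` grows exponentially: Chetaev's criterion applies within the Casimir level.

The sign of `det S` is found from `r = tanh α` or `r = coth α`. In the elliptic case `α` is the
distance of the first particle from the centre of rotation. The equilibrium condition becomes `sinh
(2q - 2α) = μ sinh 2α`, and `det S` factors: it is always negative for `coth`, and has the sign of
`1 - threshold μ α` for `tanh`. Both `threshold μ` on `α ≥ 0` and the distance as a function of `α`
are strictly increasing, which yields the critical distance. -/

theorem exists_global_solution [CompleteSpace E] {X : E → E} {K L : NNReal}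
    (hX : LipschitzWith K X) (hL : ∀ z, ‖X z‖ ≤ L) (z : E) :
    ∃ γ : ℝ → E, γ 0 = z ∧ ∀ t, HasDerivAt γ (X (γ t)) t := by
  have h0 : ∀ n : ℕ, (0 : ℝ) ∈ Icc (-(n + 1 : ℝ)) (n + 1) := fun n => by
    constructor <;> [have : (0 : ℝ) ≤ n := n.cast_nonneg; have : (0 : ℝ) ≤ n := n.cast_nonneg] <;>
      linarith
  have hPL : ∀ n : ℕ, ∃ α : ℝ → E, α 0 = z ∧
      ∀ t ∈ Ioo (-(n + 1 : ℝ)) (n + 1), HasDerivAt α (X (α t)) t := by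
    intro n
    -- The speed is at most `L`, so a curve cannot leave the ball of radius `L (n + 1)` within time
    -- `n + 1`.
    have hP : IsPicardLindelof (fun _ => X) (⟨0, h0 n⟩ : Icc (-(n + 1 : ℝ)) (n + 1)) z
        (L * (n + 1)) 0 L K :=
      { lipschitzOnWith := fun t _ => hX.lipschitzOnWith
        continuousOn := fun x _ => continuousOn_const
        norm_le := fun t _ x _ => hL x
        mul_max_le := by simp }
    obtain ⟨α, hα, h⟩ := hP.exists_eq_forall_mem_Icc_hasDerivWithinAt₀
    exact ⟨α, hα, fun t ht => (h t (Ioo_subset_Icc_self ht)).hasDerivAt (Icc_mem_nhds ht.1 ht.2)⟩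
  choose α hα hd using hPL
  have huniq : ∀ n m : ℕ, n ≤ m → ∀ t : ℝ, |t| < n + 1 → α n t = α m t := by
    intro n m hnm t ht
    have hc : (n : ℝ) ≤ m := by exact_mod_cast hnm
    have hn : (0 : ℝ) ≤ n := n.cast_nonneg
    refine ODE_solution_unique_of_mem_Ioo (v := fun _ => X) (s := fun _ => univ) (K := K)
      (a := -(n + 1 : ℝ)) (b := n + 1) (t₀ := 0) (fun _ _ => hX.lipschitzOnWith)
      ⟨by linarith, by linarith⟩
      (fun s hs => ⟨hd n s hs, trivial⟩)
      (fun s hs => ⟨hd m s ⟨by linarith [hs.1], by linarith [hs.2]⟩, trivial⟩)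
      (by rw [hα, hα]) (abs_lt.1 ht)
  -- Glue the local solutions: the index `⌈|t|⌉₊` suffices because `α n` is controlled for `|t| < n
  -- + 1`.
  refine ⟨fun t => α ⌈|t|⌉₊ t, hα _, fun t => ?_⟩
  have hev : (fun s => α ⌈|s|⌉₊ s) =ᶠ[𝓝 t] α (⌈|t|⌉₊ + 1) := by
    have : ∀ᶠ s in 𝓝 t, |s| < |t| + 1 :=
      continuous_abs.continuousAt.eventually (gt_mem_nhds (lt_add_one |t|))
    filter_upwards [this] with s hs
    refine huniq _ _ ?_ s ((Nat.le_ceil _).trans_lt (lt_add_one _))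
    refine Nat.ceil_le.2 ?_
    push_cast
    linarith [Nat.le_ceil |t|]
  have ht : α ⌈|t|⌉₊ t = α (⌈|t|⌉₊ + 1) t := hev.self_of_nhds
  have := hd (⌈|t|⌉₊ + 1) t (abs_lt.1 (by push_cast; linarith [Nat.le_ceil |t|]))
  simp only
  rw [ht]
  exact this.congr_of_eventuallyEq hev

/-- Near an equilibrium of a `C¹` vector field, solutions exist for all positive times or until they
leave a given small ball. -/
theorem exists_solution_or_exit [FiniteDimensional ℝ E] {X : E → E} {D : Set E} (hD : IsOpen D)
    (hX : ∀ z ∈ D, ContDiffAt ℝ 1 X z) {z₀ : E} (hz₀ : z₀ ∈ D) :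
    ∃ R > 0, closedBall z₀ R ⊆ D ∧ ∀ ε ≤ R, ∀ z ∈ ball z₀ ε, ∃ γ : ℝ → E, γ 0 = z ∧
      ((IsSolutionOn X D γ (Ici 0) ∧ ∀ t ∈ Ici (0 : ℝ), γ t ∈ ball z₀ ε) ∨
      ∃ T, 0 ≤ T ∧ IsSolutionOn X D γ (Icc 0 T) ∧ (∀ t ∈ Icc 0 T, γ t ∈ closedBall z₀ ε) ∧
        dist (γ T) z₀ = ε) := by
  obtain ⟨r, hr, hrD⟩ := nhds_basis_closedBall.mem_iff.1 (hD.mem_nhds hz₀)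
  -- Cutting off the field makes it bounded and globally Lipschitz without changing it on the
  -- smaller ball; the exit time is then the first time at which the global solution reaches
  -- distance `ε`.
  let χ : ContDiffBump z₀ := ⟨r / 2, r, half_pos hr, half_lt_self hr⟩
  set Y : E → E := fun z => χ z • X z with hY
  have hYd : ContDiff ℝ 1 Y := by
    refine contDiff_iff_contDiffAt.2 fun x => ?_
    by_cases hx : x ∈ tsupport Y
    swap
    · exact contDiffAt_const.congr_of_eventuallyEq (notMem_tsupport_iff_eventuallyEq.1 hx)
    have hx' : x ∈ D := hrD <| by
      have := tsupport_smul_subset_left (χ : E → ℝ) X hx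
      rwa [χ.tsupport_eq] at this
    exact χ.contDiffAt.smul (hX x hx')
  have hYs : HasCompactSupport Y := χ.hasCompactSupport.smul_right
  obtain ⟨K, hK⟩ := hYd.lipschitzWith_of_hasCompactSupport hYs one_ne_zero
  obtain ⟨L, hL⟩ := hYs.exists_bound_of_continuous hYd.continuous
  have hYX : ∀ z ∈ closedBall z₀ (r / 2), Y z = X z := fun z hz => by
    simp [hY, χ.one_of_mem_closedBall hz]
  have hsub : closedBall z₀ (r / 2) ⊆ D :=
    (closedBall_subset_closedBall (half_le_self hr.le)).trans hrD
  refine ⟨r / 2, half_pos hr, hsub, fun ε hε z hz => ?_⟩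
  have hcb : closedBall z₀ ε ⊆ closedBall z₀ (r / 2) := closedBall_subset_closedBall hε
  have : CompleteSpace E := FiniteDimensional.complete ℝ E
  obtain ⟨γ, hγ0, hγ⟩ := exists_global_solution hK (L := L.toNNReal)
    (fun z => (hL z).trans (Real.le_coe_toNNReal L)) z
  have hγc : Continuous γ := continuous_iff_continuousAt.2 fun t => (hγ t).continuousAt
  have hsol : ∀ s : Set ℝ, (∀ t ∈ s, γ t ∈ closedBall z₀ ε) → IsSolutionOn X D γ s := by
    intro s hs t ht
    have h1 := hcb (hs t ht)
    refine ⟨hsub h1, ?_⟩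
    rw [← hYX _ h1]
    exact (hγ t).hasDerivWithinAt
  refine ⟨γ, hγ0, ?_⟩
  by_cases hin : ∀ t ∈ Ici (0 : ℝ), γ t ∈ ball z₀ ε
  · exact Or.inl ⟨hsol _ fun t ht => ball_subset_closedBall (hin t ht), hin⟩
  right
  push Not at hin
  set A : Set ℝ := Ici 0 ∩ {t | ε ≤ dist (γ t) z₀} with hA
  have hAne : A.Nonempty := by
    obtain ⟨t, ht, h⟩ := hin
    exact ⟨t, ht, show ε ≤ dist (γ t) z₀ from not_lt.1 h⟩
  have hAc : IsClosed A :=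
    isClosed_Ici.inter (isClosed_le continuous_const (hγc.dist continuous_const))
  have hAb : BddBelow A := ⟨0, fun t ht => ht.1⟩
  have hT := hAc.csInf_mem hAne hAb
  set T := sInf A
  have hlt : ∀ t ∈ Ico 0 T, dist (γ t) z₀ < ε := fun t ht => by
    by_contra h
    exact absurd (csInf_le hAb ⟨ht.1, show ε ≤ dist (γ t) z₀ from not_lt.1 h⟩) (not_le.2 ht.2)
  have hT0 : 0 < T := by
    rcases (show 0 ≤ T from hT.1).lt_or_eq with h | h
    · exact h
    · exfalso
      have : ε ≤ dist (γ T) z₀ := hT.2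
      rw [← h, hγ0] at this
      exact absurd hz (not_lt.2 this)
  have hle : dist (γ T) z₀ ≤ ε := by
    have hcl : T ∈ closure (Ico 0 T) := by
      rw [closure_Ico hT0.ne]
      exact right_mem_Icc.2 hT0.le
    exact closure_minimal (fun t ht => (hlt t ht).le)
      (isClosed_le (hγc.dist continuous_const) continuous_const) hcl
  have hball : ∀ t ∈ Icc 0 T, γ t ∈ closedBall z₀ ε := fun t ht => by
    rcases ht.2.lt_or_eq with h | h
    · exact (hlt t ⟨ht.1, h⟩).le
    · exact h ▸ hle
  exact ⟨T, hT0.le, hsol _ hball, hball, le_antisymm hle hT.2⟩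

/-- An equilibrium is Lyapunov stable if some integral of motion has a strict local minimum there. -/
theorem isLyapunovStable_of_integral [FiniteDimensional ℝ E] {X : E → E} {D : Set E}
    (hD : IsOpen D) (hX : ∀ z ∈ D, ContDiffAt ℝ 1 X z) {z₀ : E} (hz₀ : z₀ ∈ D) (h0 : X z₀ = 0)
    {F : E → ℝ} (hF : ContinuousOn F D)
    (hmin : ∀ᶠ z in 𝓝 z₀, z ≠ z₀ → F z₀ < F z)
    (hcons : ∀ (γ : ℝ → E) (T : ℝ), 0 ≤ T → IsSolutionOn X D γ (Icc 0 T) → F (γ T) = F (γ 0)) :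
    IsLyapunovStable X D z₀ := by
  refine ⟨hz₀, h0, fun ε hε => ?_⟩
  obtain ⟨R, hR, hRD, hex⟩ := exists_solution_or_exit hD hX hz₀
  obtain ⟨r, hr, hrF⟩ := nhds_basis_closedBall.mem_iff.1 hmin
  set ρ := min (ε / 2) (min R r)
  have hρ : 0 < ρ := lt_min (half_pos hε) (lt_min hR hr)
  have hρε : ρ < ε := (min_le_left _ _).trans_lt (half_lt_self hε)
  have hρR : ρ ≤ R := (min_le_right _ _).trans (min_le_left _ _)
  have hρr : ρ ≤ r := (min_le_right _ _).trans (min_le_right _ _)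
  have hsub : sphere z₀ ρ ⊆ D :=
    sphere_subset_closedBall.trans ((closedBall_subset_closedBall hρR).trans hRD)
  have hδ : ∃ δ > 0, δ ≤ ρ ∧ ∀ z ∈ ball z₀ δ, ∀ w ∈ sphere z₀ ρ, F z < F w := by
    have : ProperSpace E := FiniteDimensional.proper ℝ E
    -- The sphere is empty if the space is trivial.
    rcases (sphere z₀ ρ).eq_empty_or_nonempty with he | hne
    · exact ⟨ρ, hρ, le_rfl, fun z _ w hw => absurd hw (he ▸ notMem_empty w)⟩
    obtain ⟨w₀, hw₀, hw₀min⟩ := (isCompact_sphere z₀ ρ).exists_isMinOn hne (hF.mono hsub)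
    have hlt : F z₀ < F w₀ := by
      refine hrF (closedBall_subset_closedBall hρr (sphere_subset_closedBall hw₀)) ?_
      rintro rfl
      simp only [mem_sphere, dist_self] at hw₀
      exact hρ.ne hw₀
    obtain ⟨δ, hδ, hδF⟩ := nhds_basis_ball.mem_iff.1
      ((hF.continuousAt (hD.mem_nhds hz₀)).eventually (gt_mem_nhds hlt))
    exact ⟨min δ ρ, lt_min hδ hρ, min_le_right _ _, fun z hz w hw =>
      (hδF (ball_subset_ball (min_le_left _ _) hz)).trans_le (hw₀min hw)⟩
  obtain ⟨δ, hδ, hδρ, hδF⟩ := hδ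
  refine ⟨δ, hδ, fun z _ hzδ => ⟨?_, ?_⟩⟩
  · obtain ⟨γ, hγ0, ⟨h, -⟩ | ⟨T, hT, hsol, -, hdist⟩⟩ := hex ρ hρR z (ball_subset_ball hδρ hzδ)
    · exact ⟨γ, hγ0, h⟩
    · have := hδF z hzδ (γ T) hdist
      rw [hcons γ T hT hsol, hγ0] at this
      exact absurd this (lt_irrefl _)
  · intro γ T hT hγ0 hsol t ht
    by_contra hcon
    have hc : ContinuousOn (fun s => dist (γ s) z₀) (Icc 0 t) := by
      have hγ : ContinuousOn γ (Icc 0 t) := fun s hs =>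
        ((hsol s ⟨hs.1, hs.2.trans ht.2⟩).2.continuousWithinAt).mono (Icc_subset_Icc_right ht.2)
      fun_prop
    -- An arbitrary solution is stopped where it meets the sphere of radius `ρ`, so no uniqueness of
    -- solutions is needed.
    obtain ⟨s, hs, hsρ⟩ := intermediate_value_Icc ht.1 hc
      (show ρ ∈ Icc (dist (γ 0) z₀) (dist (γ t) z₀) from
        ⟨by rw [hγ0]; exact (hzδ.trans_le hδρ).le, hρε.le.trans (not_lt.1 hcon)⟩)
    have hsol' : IsSolutionOn X D γ (Icc 0 s) := fun u hu =>
      have hss : Icc 0 s ⊆ Icc 0 T := Icc_subset_Icc_right (hs.2.trans ht.2)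
      ⟨(hsol u (hss hu)).1, (hsol u (hss hu)).2.mono hss⟩
    have := hδF z hzδ (γ s) hsρ
    rw [hcons γ s hs.1 hsol', hγ0] at this
    exact lt_irrefl _ this

/-- Chetaev's criterion: an equilibrium is unstable if there is a function `V` that grows at
least at the rate `c V` along the solutions in an invariant set `A`, wherever it is positive,
and if `A` contains points with `V > 0` arbitrarily near the equilibrium. -/
theorem isLyapunovUnstableWithin_of_chetaev [FiniteDimensional ℝ E] {X : E → E} {D S A : Set E}
    (hD : IsOpen D) (hX : ∀ z ∈ D, ContDiffAt ℝ 1 X z) {z₀ : E} (hz₀ : z₀ ∈ D) (h0 : X z₀ = 0)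
    (hAS : A ⊆ S)
    (hinv : ∀ (γ : ℝ → E) (T : ℝ), 0 ≤ T → IsSolutionOn X D γ (Icc 0 T) → γ 0 ∈ A → γ T ∈ A)
    {V W : E → ℝ} (hV : ContinuousOn V D)
    (hVW : ∀ (γ : ℝ → E) (s : Set ℝ), IsSolutionOn X D γ s →
      ∀ t ∈ s, HasDerivWithinAt (fun t => V (γ t)) (W (γ t)) s t)
    {c : ℝ} (hc : 0 < c) (hgrow : ∀ᶠ z in 𝓝 z₀, z ∈ A → 0 < V z → c * V z ≤ W z)
    (hnear : ∃ᶠ z in 𝓝 z₀, z ∈ A ∧ 0 < V z) :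
    IsLyapunovUnstableWithin X D S z₀ := by
  refine ⟨hz₀, h0, ?_⟩
  obtain ⟨R, hR, hRD, hex⟩ := exists_solution_or_exit hD hX hz₀
  obtain ⟨r, hr, hrF⟩ := nhds_basis_closedBall.mem_iff.1 hgrow
  set ε := min R r
  have hε : 0 < ε := lt_min hR hr
  have hεD : closedBall z₀ ε ⊆ D := (closedBall_subset_closedBall (min_le_left _ _)).trans hRD
  have hεF : ∀ z ∈ closedBall z₀ ε, z ∈ A → 0 < V z → c * V z ≤ W z := fun z hz =>
    hrF (closedBall_subset_closedBall (min_le_right _ _) hz)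
  have : ProperSpace E := FiniteDimensional.proper ℝ E
  obtain ⟨B, hB⟩ := (isCompact_closedBall z₀ ε).exists_bound_of_continuousOn (hV.mono hεD)
  refine ⟨ε, hε, fun δ hδ => ?_⟩
  obtain ⟨z, ⟨hzA, hVz⟩, hzδ⟩ :=
    (hnear.and_eventually (ball_mem_nhds z₀ (lt_min hε hδ))).exists
  obtain ⟨γ, hγ0, ⟨hsol, hball⟩ | ⟨T, hT, hsol, -, hdist⟩⟩ :=
    hex ε (min_le_left _ _) z (ball_subset_ball (min_le_left _ _) hzδ)
  swap
  · exact ⟨γ, T, hT, hsol, hγ0 ▸ hAS hzA, hγ0 ▸ hzδ.trans_le (min_le_right _ _), hdist.ge⟩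
  exfalso
  have hA : ∀ t, 0 ≤ t → γ t ∈ A := fun t ht =>
    hinv γ t ht (fun s hs => ⟨(hsol s hs.1).1, (hsol s hs.1).2.mono Icc_subset_Ici_self⟩)
      (hγ0 ▸ hzA)
  have hd := hVW γ _ hsol
  have hcont : ContinuousOn (fun t => V (γ t)) (Ici 0) := fun t ht => (hd t ht).continuousWithinAt
  have hrate : ∀ t, 0 ≤ t → 0 < V (γ t) → c * V (γ t) ≤ W (γ t) := fun t ht hp =>
    hεF _ (ball_subset_closedBall (hball t ht)) (hA t ht) hp
  -- A linear lower bound already contradicts the boundedness of `V` on the compact ball. The slope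
  -- `c * V z / 2` is half the available rate, so that the comparison of derivatives is strict.
  have hlow : ∀ t, 0 ≤ t → V z + c * V z / 2 * t ≤ V (γ t) := by
    intro T hT
    refine image_le_of_deriv_right_lt_deriv_boundary'
      (f := fun t => V z + c * V z / 2 * t) (f' := fun _ => c * V z / 2)
      (B := fun t => V (γ t)) (B' := fun t => W (γ t)) (a := 0) (b := T)
      (by fun_prop) (fun t _ => ?_) (by simp [hγ0])
      (hcont.mono Icc_subset_Ici_self) (fun t ht => ?_) (fun t ht heq => ?_)
      (right_mem_Icc.2 hT)
    · simpa using (((hasDerivAt_id t).const_mul (c * V z / 2)).const_add (V z)).hasDerivWithinAt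
    · exact (hd t ht.1).mono (Ici_subset_Ici.2 ht.1)
    · have h1 : V z ≤ V (γ t) := by
        rw [← heq]
        have := mul_nonneg (by positivity : 0 ≤ c * V z / 2) ht.1
        linarith
      have h2 := hrate t ht.1 (hVz.trans_le h1)
      nlinarith [mul_pos hc hVz, mul_le_mul_of_nonneg_left h1 hc.le]
  have hpos : 0 < c * V z / 2 := by positivity
  have hup : ∀ t, 0 ≤ t → V (γ t) ≤ B := fun t ht =>
    (le_abs_self _).trans (hB _ (ball_subset_closedBall (hball t ht)))
  have hB0 : 0 ≤ B := (norm_nonneg _).trans (hB z₀ (mem_closedBall_self hε.le))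
  have h1 := hlow (B / (c * V z / 2)) (by positivity)
  have h2 := hup (B / (c * V z / 2)) (by positivity)
  rw [mul_div_cancel₀ _ hpos.ne'] at h1
  linarith

end ODE

/-! ### The reduced field as a polynomial in `m`, `p` and `coth q` -/

section Field

/-- The hyperbolic cotangent. -/
def coth (q : ℝ) : ℝ := Real.cosh q / Real.sinh q

theorem hasDerivAt_coth {q : ℝ} (hq : 0 < q) : HasDerivAt coth (1 - coth q ^ 2) q := by
  have hs : Real.sinh q ≠ 0 := (Real.sinh_pos_iff.2 hq).ne'
  refine ((Real.hasDerivAt_cosh q).div (Real.hasDerivAt_sinh q) hs).congr_deriv ?_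
  unfold coth
  field_simp

theorem one_lt_coth {q : ℝ} (hq : 0 < q) : 1 < coth q := by
  have hs : 0 < Real.sinh q := Real.sinh_pos_iff.2 hq
  rw [coth, one_lt_div hs]
  exact Real.sinh_lt_cosh q

theorem contDiffAt_coth {n : WithTop ℕ∞} {q : ℝ} (hq : 0 < q) : ContDiffAt ℝ n coth q :=
  Real.contDiff_cosh.contDiffAt.div Real.contDiff_sinh.contDiffAt (Real.sinh_pos_iff.2 hq).ne'

/-- The reduced Hamiltonian in the variable `c = coth q`, multiplied by `μ₁`. -/
def energy (M g x y z c p : ℝ) : ℝ :=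
  1 / 2 * (x ^ 2 + y ^ 2 - 2 * c * y * z + (M * (c ^ 2 - 1) + 1) * z ^ 2 - 2 * x * p + M * p ^ 2)
    - g * c

/-- Since `1 / sinh² q = coth² q - 1`, the last entry of the inertia matrix is a quadratic
polynomial in `coth q`; the potential is linear in it. -/
theorem hamiltonian_eq (G : ℝ) {μ₁ μ₂ : ℝ} (hμ₁ : μ₁ ≠ 0) (m : Vec) {q : ℝ} (hq : 0 < q) (p : ℝ) :
    hamiltonian μ₁ μ₂ (gravPotential G μ₁ μ₂) m q p =
      1 / μ₁ * energy (1 + μ₁ / μ₂) (G * μ₁ ^ 2 * μ₂) (m 0) (m 1) (m 2) (coth q) p := by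
  have hs : Real.sinh q ≠ 0 := (Real.sinh_pos_iff.2 hq).ne'
  have hc : Real.cosh q ≠ 0 := (Real.cosh_pos q).ne'
  have h : (μ₁ / μ₂ + Real.cosh q ^ 2) / Real.sinh q ^ 2
      = (1 + μ₁ / μ₂) * (coth q ^ 2 - 1) + 1 := by
    have := Real.cosh_sq q
    rw [coth, div_pow, this]
    generalize μ₁ / μ₂ = μ
    field_simp
    ring
  have hU : gravPotential G μ₁ μ₂ q = - (G * μ₁ * μ₂) * coth q := by
    rw [gravPotential, Real.tanh_eq_sinh_div_cosh, coth]
    field_simp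
  rw [hamiltonian, hU, inertia, h, energy, ← coth]
  simp only [dotProduct, Matrix.mulVec, Fin.sum_univ_three, Matrix.of_apply, Matrix.cons_val]
  generalize μ₁ / μ₂ = μ
  field_simp
  ring

/-- The reduced vector field in the variable `c = coth q`, multiplied by `μ₁`. -/
def fieldX (M y z c : ℝ) : ℝ := -c * y ^ 2 + (M * (c ^ 2 - 1) + 2) * y * z - c * z ^ 2

def fieldY (M x y z c p : ℝ) : ℝ := z * p - (M * (c ^ 2 - 1) + 2) * x * z + c * x * y

def fieldZ (x y z c p : ℝ) : ℝ := y * p - c * x * z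

def fieldP (M g y z c : ℝ) : ℝ := (c ^ 2 - 1) * (M * c * z ^ 2 - y * z - g)

/-- The explicit form of the reduced vector field. -/
def polyField (M g μ₁ : ℝ) (z : RedVec) : RedVec :=
  (![1 / μ₁ * fieldX M (z.1 1) (z.1 2) (coth z.2.1),
     1 / μ₁ * fieldY M (z.1 0) (z.1 1) (z.1 2) (coth z.2.1) z.2.2,
     1 / μ₁ * fieldZ (z.1 0) (z.1 1) (z.1 2) (coth z.2.1) z.2.2],
   1 / μ₁ * (M * z.2.2 - z.1 0),
   1 / μ₁ * fieldP M g (z.1 1) (z.1 2) (coth z.2.1))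

theorem redField_eq (G : ℝ) {μ₁ μ₂ : ℝ} (hμ₁ : μ₁ ≠ 0) {z : RedVec} (hz : z ∈ redSpace) :
    redField μ₁ μ₂ (gravPotential G μ₁ μ₂) z =
      polyField (1 + μ₁ / μ₂) (G * μ₁ ^ 2 * μ₂) μ₁ z := by
  obtain ⟨m, q, p⟩ := z
  have hq : 0 < q := hz
  unfold redField polyField
  simp only
  have hm : (fun m => hamiltonian μ₁ μ₂ (gravPotential G μ₁ μ₂) m q p) = fun m : Vec =>
      1 / μ₁ * energy (1 + μ₁ / μ₂) (G * μ₁ ^ 2 * μ₂) (m 0) (m 1) (m 2) (coth q) p :=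
    funext fun m => hamiltonian_eq G hμ₁ m hq p
  have hp : (fun p => hamiltonian μ₁ μ₂ (gravPotential G μ₁ μ₂) m q p) = fun p =>
      1 / μ₁ * energy (1 + μ₁ / μ₂) (G * μ₁ ^ 2 * μ₂) (m 0) (m 1) (m 2) (coth q) p :=
    funext fun p => hamiltonian_eq G hμ₁ m hq p
  have hqe : (fun q => hamiltonian μ₁ μ₂ (gravPotential G μ₁ μ₂) m q p) =ᶠ[nhds q] fun q =>
      1 / μ₁ * energy (1 + μ₁ / μ₂) (G * μ₁ ^ 2 * μ₂) (m 0) (m 1) (m 2) (coth q) p := by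
    filter_upwards [lt_mem_nhds hq] with q' hq' using hamiltonian_eq G hμ₁ m hq' p
  rw [hm, hp, hqe.deriv_eq]
  generalize G * μ₁ ^ 2 * μ₂ = g
  generalize 1 + μ₁ / μ₂ = M
  have hderm : ∀ i, fderiv ℝ (fun m : Vec => 1 / μ₁ * energy M g (m 0) (m 1) (m 2) (coth q) p) m
      (Pi.single i 1) = 1 / μ₁ * ![m 0 - p, m 1 - coth q * m 2,
        -coth q * m 1 + (M * (coth q ^ 2 - 1) + 1) * m 2] i := by
    have hc : ∀ i : Fin 3, HasFDerivAt (fun m : Vec => m i)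
        (ContinuousLinearMap.proj i : Vec →L[ℝ] ℝ) m := fun i => hasFDerivAt_apply i m
    have h1 := (((hc 0).pow 2).add ((hc 1).pow 2)).sub
      (((hc 1).const_mul (2 * coth q)).mul (hc 2))
    have h := ((((h1.add (((hc 2).pow 2).const_mul (M * (coth q ^ 2 - 1) + 1))).sub
      (((hc 0).const_mul 2).mul_const p)).add_const (M * p ^ 2)).const_mul (1 / 2)).sub_const
      (g * coth q) |>.const_mul (1 / μ₁)
    intro i
    have h2 : HasFDerivAt (fun m : Vec => 1 / μ₁ * energy M g (m 0) (m 1) (m 2) (coth q) p) _ m := h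
    rw [h2.fderiv]
    fin_cases i <;> simp [-mul_eq_mul_left_iff] <;> ring
  have hderp : deriv (fun p => 1 / μ₁ * energy M g (m 0) (m 1) (m 2) (coth q) p) p =
      1 / μ₁ * (M * p - m 0) := by
    have hi := hasDerivAt_id p
    have h1 := ((hi.const_mul (2 * m 0)).const_sub (m 0 ^ 2 + m 1 ^ 2 - 2 * coth q * m 1 * m 2 +
      (M * (coth q ^ 2 - 1) + 1) * m 2 ^ 2)).add ((hi.pow 2).const_mul M)
    have h : HasDerivAt (fun p => 1 / μ₁ * energy M g (m 0) (m 1) (m 2) (coth q) p) _ p :=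
      ((h1.const_mul (1 / 2)).sub_const (g * coth q)).const_mul (1 / μ₁)
    rw [h.deriv]
    simp [-mul_eq_mul_left_iff]
    ring
  have hderq : deriv (fun q => 1 / μ₁ * energy M g (m 0) (m 1) (m 2) (coth q) p) q =
      -(1 / μ₁ * fieldP M g (m 1) (m 2) (coth q)) := by
    have hi := hasDerivAt_coth hq
    have h1 := ((((hi.const_mul 2).mul_const (m 1)).mul_const (m 2)).const_sub
      (m 0 ^ 2 + m 1 ^ 2)).add
      (((((hi.pow 2).sub_const 1).const_mul M).add_const 1).mul_const (m 2 ^ 2))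
    have h : HasDerivAt (fun q => 1 / μ₁ * energy M g (m 0) (m 1) (m 2) (coth q) p) _ q :=
      ((((h1.sub_const (2 * m 0 * p)).add_const (M * p ^ 2)).const_mul (1 / 2)).sub
        (hi.const_mul g)).const_mul (1 / μ₁)
    rw [h.deriv]
    simp [fieldP]
    ring
  rw [hderp, hderq]
  simp only [hderm]
  refine Prod.ext ?_ (Prod.ext rfl (neg_neg _))
  simp only [K, Matrix.mulVec_diagonal, cross_apply, fieldX, fieldY, fieldZ, Matrix.cons_val]
  ext i
  fin_cases i <;> simp <;> ring

theorem isOpen_redSpace : IsOpen redSpace :=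
  isOpen_lt continuous_const (continuous_fst.comp continuous_snd)

theorem contDiffAt_polyField (M g μ₁ : ℝ) {z : RedVec} (hz : z ∈ redSpace) {n : WithTop ℕ∞} :
    ContDiffAt ℝ n (polyField M g μ₁) z := by
  have hc : ContDiffAt ℝ n (fun z : RedVec => coth z.2.1) z :=
    ContDiffAt.comp z (contDiffAt_coth hz) (contDiffAt_fst.comp z contDiffAt_snd)
  unfold polyField fieldX fieldY fieldZ fieldP
  refine ContDiffAt.prodMk (contDiffAt_pi.2 fun i => ?_) (ContDiffAt.prodMk ?_ ?_)
  · fin_cases i <;> simp <;> fun_prop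
  · fun_prop
  · fun_prop

theorem contDiffAt_redField (G : ℝ) {μ₁ μ₂ : ℝ} (hμ₁ : μ₁ ≠ 0) {z : RedVec} (hz : z ∈ redSpace) :
    ContDiffAt ℝ 1 (redField μ₁ μ₂ (gravPotential G μ₁ μ₂)) z :=
  (contDiffAt_polyField _ _ _ hz).congr_of_eventuallyEq <| by
    filter_upwards [isOpen_redSpace.mem_nhds hz] with w hw using redField_eq G hμ₁ hw

end Field

/-! ### Relative equilibria in the moving frame -/

section RelativeEquilibria

theorem mink_eq (x y : Vec) : mink x y = x 0 * y 0 + x 1 * y 1 - x 2 * y 2 := by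
  simp [mink, K, Matrix.mulVec_diagonal, dotProduct, Fin.sum_univ_three]
  ring

theorem mink_comm (x y : Vec) : mink x y = mink y x := by
  rw [mink_eq, mink_eq]; ring

theorem mink_mulVec {g : Matrix (Fin 3) (Fin 3) ℝ} (hg : gᵀ * K * g = K) (x y : Vec) :
    mink (g *ᵥ x) (g *ᵥ y) = mink x y := by
  rw [mink, mink, ← Matrix.vecMul_transpose, ← Matrix.dotProduct_mulVec, Matrix.mulVec_mulVec,
    Matrix.mulVec_mulVec, hg]

theorem K_mul_K : K * K = 1 := by
  rw [K, Matrix.diagonal_mul_diagonal, ← Matrix.diagonal_one]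
  congr 1
  ext i
  fin_cases i <;> simp

/-- Pairing both sides with a vector `w` gives the triple product of `N w`, `N u`, `N v`, which is
`det N` times that of `w`, `u`, `v`. -/
theorem transpose_mulVec_cross (N : Matrix (Fin 3) (Fin 3) ℝ) (u v : Vec) :
    Nᵀ *ᵥ ((N *ᵥ u) ⨯₃ (N *ᵥ v)) = N.det • (u ⨯₃ v) := by
  rw [Matrix.det_fin_three]
  ext i
  fin_cases i <;>
  · simp [cross_apply, Matrix.mulVec, dotProduct, Fin.sum_univ_three]
    ring

/-- The Lorentz-covariance of the cross product. -/
theorem cross_mulVec {g : Matrix (Fin 3) (Fin 3) ℝ} (hg : gᵀ * K * g = K) (hdet : g.det = 1)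
    (x y : Vec) : (K *ᵥ (g *ᵥ x)) ⨯₃ (K *ᵥ (g *ᵥ y)) = g *ᵥ ((K *ᵥ x) ⨯₃ (K *ᵥ y)) := by
  have hKT : Kᵀ = K := by rw [K, Matrix.diagonal_transpose]
  have hdK : K.det * K.det = 1 := by rw [← Matrix.det_mul, K_mul_K, Matrix.det_one]
  -- The matrix `N = K g K` carries `K u` to `K g u`, and the Lorentz condition on `g` says `g Nᵀ =
  -- 1`; the cofactor identity for `N` then gives the claim.
  have hN : ∀ u : Vec, K *ᵥ (g *ᵥ u) = (K * g * K) *ᵥ (K *ᵥ u) := fun u => by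
    rw [Matrix.mulVec_mulVec, Matrix.mulVec_mulVec, Matrix.mul_assoc (K * g), K_mul_K,
      Matrix.mul_one]
  have hNT : (K * g * K)ᵀ = K * gᵀ * K := by
    rw [Matrix.transpose_mul, Matrix.transpose_mul, hKT, Matrix.mul_assoc]
  have hinv : g * (K * g * K)ᵀ = 1 := by
    rw [hNT]
    refine mul_eq_one_comm.1 ?_
    rw [Matrix.mul_assoc K, Matrix.mul_assoc K, hg, K_mul_K]
  have hdN : (K * g * K).det = 1 := by
    rw [Matrix.det_mul, Matrix.det_mul, hdet, mul_one, hdK]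
  have h := transpose_mulVec_cross (K * g * K) (K *ᵥ x) (K *ᵥ y)
  rw [hdN, one_smul, ← hN, ← hN] at h
  rw [← h, Matrix.mulVec_mulVec _ g, hinv, Matrix.one_mulVec]

theorem IsGenerator.exists_eq {η : Matrix (Fin 3) (Fin 3) ℝ} (h : IsGenerator η) :
    ∃ u v w : ℝ, η = !![0, -w, v; w, 0, -u; v, -u, 0] := by
  have e : ∀ i j, (ηᵀ * K + K * η) i j = 0 := fun i j => by rw [h]; rfl
  simp only [K, Matrix.add_apply, Matrix.mul_diagonal, Matrix.diagonal_mul,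
    Matrix.transpose_apply] at e
  refine ⟨-η 2 1, η 0 2, η 1 0, ?_⟩
  have e00 := e 0 0
  have e11 := e 1 1
  have e22 := e 2 2
  have e01 := e 0 1
  have e02 := e 0 2
  have e12 := e 1 2
  simp at e00 e11 e22 e01 e02 e12
  ext i j
  fin_cases i <;> fin_cases j <;> simp <;> linarith

theorem hasDerivAt_exp_smul_mulVec (ξ : Matrix (Fin 3) (Fin 3) ℝ) (x : Vec) (t : ℝ) :
    HasDerivAt (fun t : ℝ => NormedSpace.exp (t • ξ) *ᵥ x)
      (ξ *ᵥ (NormedSpace.exp (t • ξ) *ᵥ x)) t := by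
  let : NormedRing (Matrix (Fin 3) (Fin 3) ℝ) := Matrix.linftyOpNormedRing
  let : NormedAlgebra ℝ (Matrix (Fin 3) (Fin 3) ℝ) := Matrix.linftyOpNormedAlgebra
  have h := hasDerivAt_exp_smul_const' (𝕂 := ℝ) ξ t
  let ℓ : Matrix (Fin 3) (Fin 3) ℝ →ₗ[ℝ] Vec :=
    { toFun := fun A => A *ᵥ x
      map_add' := fun A B => Matrix.add_mulVec A B x
      map_smul' := fun a A => Matrix.smul_mulVec a A x }
  have h2 := (LinearMap.toContinuousLinearMap ℓ).hasFDerivAt.comp_hasDerivAt t h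
  rw [Matrix.mulVec_mulVec]
  exact h2

theorem gravPotential_eq (G μ₁ μ₂ q : ℝ) :
    gravPotential G μ₁ μ₂ q = -(G * μ₁ * μ₂) * coth q := by
  rw [gravPotential, Real.tanh_eq_sinh_div_cosh, coth, div_div_eq_mul_div, mul_div_assoc]

/-- Chain rule: `cosh` of the distance is a linear function of `x`, `arcosh` contributes `1 / sinh
q`, and the potential contributes `G μ₁ μ₂ / sinh² q`. -/
theorem fderiv_gravPotential_hdist (G μ₁ μ₂ : ℝ) {x y : Vec} {q : ℝ} (hq : 0 < q)
    (h : mink x y = -Real.cosh q) (w : Vec) :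
    fderiv ℝ (fun x => gravPotential G μ₁ μ₂ (hdist x y)) x w =
      -(G * μ₁ * μ₂ / Real.sinh q ^ 3) * mink w y := by
  have hs : 0 < Real.sinh q := Real.sinh_pos_iff.2 hq
  let ℓ : Vec →ₗ[ℝ] ℝ :=
    { toFun := fun x => -mink x y
      map_add' := fun a b => by simp only [mink_eq, Pi.add_apply]; ring
      map_smul' := fun a b => by simp only [mink_eq, Pi.smul_apply, smul_eq_mul, RingHom.id_apply]; ring }
  have h1 : HasFDerivAt (fun x => -mink x y) (LinearMap.toContinuousLinearMap ℓ) x :=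
    (LinearMap.toContinuousLinearMap ℓ).hasFDerivAt
  have h2 : HasDerivAt Real.arcosh (Real.sinh q)⁻¹ (-mink x y) := by
    rw [h, neg_neg]
    have := Real.hasDerivAt_arcosh (x := Real.cosh q) (Real.one_lt_cosh.2 hq.ne')
    rwa [Real.cosh_sq, add_sub_cancel_right, Real.sqrt_sq hs.le] at this
  have h3 : HasDerivAt (gravPotential G μ₁ μ₂) (-(G * μ₁ * μ₂) * (1 - coth q ^ 2))
      (Real.arcosh (-mink x y)) := by
    rw [h, neg_neg, Real.arcosh_cosh hq.le]
    rw [show gravPotential G μ₁ μ₂ = fun q => -(G * μ₁ * μ₂) * coth q from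
      funext (gravPotential_eq G μ₁ μ₂)]
    exact (hasDerivAt_coth hq).const_mul _
  have h4 := (h3.comp _ h2).comp_hasFDerivAt x h1
  have h5 := HasFDerivAt.fderiv h4
  change fderiv ℝ (fun x => gravPotential G μ₁ μ₂ (hdist x y)) x = _ at h5
  rw [h5]
  change -(G * μ₁ * μ₂) * (1 - coth q ^ 2) * (Real.sinh q)⁻¹ * (-mink w y) = _
  have hc : 1 - coth q ^ 2 = -1 / Real.sinh q ^ 2 := by
    rw [coth, div_pow, Real.cosh_sq]
    field_simp
    ring
  rw [hc]
  field_simp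

variable {G μ₁ μ₂ : ℝ} {ξ : Matrix (Fin 3) (Fin 3) ℝ} {R₁ R₂ : ℝ → Vec} {t : ℝ} {z : RedVec}

theorem deriv_of_orbit {R : ℝ → Vec} (h : ∀ t, R t = NormedSpace.exp (t • ξ) *ᵥ R 0) :
    (∀ t, deriv R t = ξ *ᵥ R t) ∧ ∀ t, deriv (deriv R) t = ξ *ᵥ (ξ *ᵥ R t) := by
  have h1 : ∀ t, HasDerivAt R (ξ *ᵥ R t) t := fun t => by
    have := hasDerivAt_exp_smul_mulVec ξ (R 0) t
    rw [← h t] at this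
    exact this.congr_of_eventuallyEq (Filter.Eventually.of_forall h)
  refine ⟨fun t => (h1 t).deriv, fun t => ?_⟩
  rw [funext fun t => (h1 t).deriv]
  have := (LinearMap.toContinuousLinearMap ξ.mulVecLin).hasFDerivAt.comp_hasDerivAt t (h1 t)
  exact this.deriv

/-- The equations of a relative equilibrium in the moving frame. -/
theorem IsRelativeEquilibrium.exists_frame_velocity (hG : 0 < G) (hμ₁ : 0 < μ₁) (hμ₂ : 0 < μ₂)
    (hre : IsRelativeEquilibrium μ₁ μ₂ (gravPotential G μ₁ μ₂) ξ R₁ R₂)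
    (hz : IsReducedState μ₁ μ₂ (R₁ t) (R₂ t) (deriv R₁ t) (deriv R₂ t) z) :
    hdist (R₁ t) (R₂ t) = z.2.1 ∧ ∃ v w f : ℝ,
      f = v * Real.cosh z.2.1 - w * Real.sinh z.2.1 ∧
      z = (![0, -(μ₁ * v) - μ₂ * Real.cosh z.2.1 * f, -(μ₂ * Real.sinh z.2.1 * f)], z.2.1, 0) ∧
      μ₁ * (w * v) = G * μ₁ * μ₂ / Real.sinh z.2.1 ^ 2 ∧
      μ₂ * (f * (w * Real.cosh z.2.1 - v * Real.sinh z.2.1)) =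
        -(G * μ₁ * μ₂ / Real.sinh z.2.1 ^ 2) ∧
      (IsElliptic ξ → v ^ 2 < w ^ 2) ∧ (IsHyperbolic ξ → w ^ 2 < v ^ 2) := by
  obtain ⟨hmot, hgen, horb⟩ := hre
  obtain ⟨m, q, p⟩ := z
  obtain ⟨hq, g, hg, hdet, hx₁, hx₂, hm, hp⟩ := hz
  replace hq : 0 < q := hq
  simp only at hx₂ hm hp ⊢
  have hs : 0 < Real.sinh q := Real.sinh_pos_iff.2 hq
  have hcs := Real.cosh_sq q
  obtain ⟨hd₁, hdd₁⟩ := deriv_of_orbit fun t => (horb t).1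
  obtain ⟨hd₂, hdd₂⟩ := deriv_of_orbit fun t => (horb t).2
  have hgu : IsUnit g.det := by rw [hdet]; exact isUnit_one
  -- `η = g⁻¹ ξ g` is the generator seen from the moving frame; it again lies in `so(2,1)`.
  obtain ⟨η, hξg⟩ : ∃ η, ξ * g = g * η := ⟨g⁻¹ * (ξ * g), by
    rw [← Matrix.mul_assoc g, Matrix.mul_nonsing_inv _ hgu, Matrix.one_mul]⟩
  have hηgen : IsGenerator η := by
    have h1 : ηᵀ * K = gᵀ * (ξᵀ * K) * g := by
      calc ηᵀ * K = (g * η)ᵀ * K * g := by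
            rw [Matrix.transpose_mul, Matrix.mul_assoc, Matrix.mul_assoc, ← Matrix.mul_assoc gᵀ K g,
              hg]
        _ = _ := by
            rw [← hξg, Matrix.transpose_mul]
            simp only [Matrix.mul_assoc]
    have h2 : K * η = gᵀ * (K * ξ) * g := by
      calc K * η = gᵀ * K * (g * η) := by rw [← Matrix.mul_assoc (gᵀ * K) g η, hg]
        _ = _ := by
            rw [← hξg]
            simp only [Matrix.mul_assoc]
    rw [IsGenerator, h1, h2, ← Matrix.add_mul, ← Matrix.mul_add, hgen]
    simp
  have hmv : ∀ x : Vec, ξ *ᵥ (g *ᵥ x) = g *ᵥ (η *ᵥ x) := fun x => by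
    rw [Matrix.mulVec_mulVec, hξg, Matrix.mulVec_mulVec]
  have hinj : ∀ x y : Vec, g *ᵥ x = g *ᵥ y → x = y := fun x y hxy =>
    Matrix.mulVec_injective_iff_isUnit.2 ((Matrix.isUnit_iff_isUnit_det g).2 hgu) hxy
  obtain ⟨u, v, w, hηe⟩ := hηgen.exists_eq
  have hηv : ∀ x : Vec, η *ᵥ x =
      ![-(w * x 1) + v * x 2, w * x 0 - u * x 2, v * x 0 - u * x 1] := fun x => by
    rw [hηe]
    ext i
    fin_cases i <;> simp [Matrix.mulVec, dotProduct, Fin.sum_univ_three] <;> ring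
  have hmink : mink (R₁ t) (R₂ t) = -Real.cosh q := by
    rw [hx₁, hx₂, mink_mulVec hg, mink_eq]
    simp
  have hdist : hdist (R₁ t) (R₂ t) = q := by
    rw [LobachevskyTwoBody.hdist, hmink, neg_neg, Real.arcosh_cosh hq.le]
  have hN₁ : ∀ e : Vec, mink ![0, 0, 1] e = 0 →
      μ₁ * mink (η *ᵥ (η *ᵥ ![0, 0, 1])) e =
        G * μ₁ * μ₂ / Real.sinh q ^ 3 * mink e ![0, Real.sinh q, Real.cosh q] := by
    intro e he
    have := hmot.newton₁ t (g *ᵥ e) (by rw [hx₁, mink_mulVec hg, he])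
    rw [fderiv_gravPotential_hdist G μ₁ μ₂ hq hmink, hdd₁, hx₁, hx₂, hmv, hmv, mink_mulVec hg,
      mink_mulVec hg] at this
    rw [this]
    ring
  have hN₂ : ∀ e : Vec, mink ![0, Real.sinh q, Real.cosh q] e = 0 →
      μ₂ * mink (η *ᵥ (η *ᵥ ![0, Real.sinh q, Real.cosh q])) e =
        G * μ₁ * μ₂ / Real.sinh q ^ 3 * mink e ![0, 0, 1] := by
    intro e he
    have := hmot.newton₂ t (g *ᵥ e) (by rw [hx₂, mink_mulVec hg, he])
    rw [show (fun x => gravPotential G μ₁ μ₂ (LobachevskyTwoBody.hdist (R₁ t) x)) =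
      fun x => gravPotential G μ₁ μ₂ (LobachevskyTwoBody.hdist x (R₁ t)) from
      funext fun x => by rw [LobachevskyTwoBody.hdist, mink_comm, LobachevskyTwoBody.hdist]] at this
    rw [fderiv_gravPotential_hdist G μ₁ μ₂ hq ((mink_comm _ _).trans hmink), hdd₂, hx₁, hx₂, hmv,
      hmv, mink_mulVec hg, mink_mulVec hg] at this
    rw [this]
    ring
  -- Newton's equation of the first particle is tested across and along the geodesic joining the
  -- particles. Along it the attraction is nonzero, so `w v ≠ 0`; across it there is no force, so `w
  -- u = 0` and hence `u = 0`.
  have e1 := hN₁ ![1, 0, 0] (by simp [mink_eq])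
  have e2 := hN₁ ![0, 1, 0] (by simp [mink_eq])
  simp only [hηv, mink_eq] at e1 e2
  simp at e1 e2
  have hU : 0 < G * μ₁ * μ₂ / Real.sinh q ^ 2 := by positivity
  have hU3 : G * μ₁ * μ₂ / Real.sinh q ^ 3 * Real.sinh q = G * μ₁ * μ₂ / Real.sinh q ^ 2 := by
    field_simp
  rw [hU3] at e2
  have hwv : w * v ≠ 0 := by
    intro h
    rw [h, mul_zero] at e2
    exact hU.ne e2
  have hw : w ≠ 0 := left_ne_zero_of_mul hwv
  have hv : v ≠ 0 := right_ne_zero_of_mul hwv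
  have hu : u = 0 := by
    rcases e1 with h | h | h
    · exact absurd h hμ₁.ne'
    · exact absurd h hw
    · exact h
  subst hu
  have e3 := hN₂ ![0, Real.cosh q, Real.sinh q] (by simp [mink_eq]; ring)
  simp only [hηv, mink_eq] at e3
  simp at e3
  rw [hU3] at e3
  refine ⟨hdist, v, w, v * Real.cosh q - w * Real.sinh q, rfl, ?_, e2, ?_, ?_⟩
  · have hp0 : p = 0 := by
      rw [hp, hd₂, hx₂, hmv, mink_mulVec hg, hηv, mink_eq]
      simp
    have hm0 : m = ![0, -(μ₁ * v) - μ₂ * Real.cosh q * (v * Real.cosh q - w * Real.sinh q),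
        -(μ₂ * Real.sinh q * (v * Real.cosh q - w * Real.sinh q))] := by
      have := hm
      rw [angularMomentum, hd₁, hd₂, hx₁, hx₂, hmv, hmv, cross_mulVec hg hdet, cross_mulVec hg hdet,
        ← Matrix.mulVec_smul, ← Matrix.mulVec_smul, ← Matrix.mulVec_add] at this
      rw [← hinj _ _ this, hηv, hηv, K]
      ext i
      fin_cases i <;> simp [Matrix.mulVec_diagonal, cross_apply] <;> ring
    rw [hp0, hm0]
  · linear_combination e3
  · have hker : ∀ n : Vec, ξ *ᵥ n = 0 → ∃ k : ℝ, mink n n = k ^ 2 * (v ^ 2 - w ^ 2) := by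
      intro n hn
      have hn' : n = g *ᵥ (g⁻¹ *ᵥ n) := by
        rw [Matrix.mulVec_mulVec, Matrix.mul_nonsing_inv _ hgu, Matrix.one_mulVec]
      set n' := g⁻¹ *ᵥ n
      have h0 : η *ᵥ n' = 0 := hinj _ _ (by rw [← hmv, ← hn', hn, Matrix.mulVec_zero])
      rw [hηv] at h0
      have c0 := congrFun h0 0
      have c1 := congrFun h0 1
      simp [hw] at c0 c1
      refine ⟨n' 2 / w, ?_⟩
      have c2 : n' 1 = n' 2 * v / w := by field_simp; linarith
      rw [hn', mink_mulVec hg, mink_eq, c1, c2]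
      field_simp
      ring
    constructor
    · rintro ⟨-, -, n, hn, h0⟩
      obtain ⟨k, hk⟩ := hker n h0
      rw [hk] at hn
      by_contra hcon
      nlinarith [mul_nonneg (sq_nonneg k) (sub_nonneg.2 (not_lt.1 hcon))]
    · rintro ⟨-, -, n, hn, h0⟩
      obtain ⟨k, hk⟩ := hker n h0
      rw [hk] at hn
      by_contra hcon
      nlinarith [mul_nonneg (sq_nonneg k) (sub_nonneg.2 (not_lt.1 hcon))]

/-- The conditions for `((0, r Z, Z), q, 0)` to be an equilibrium of the reduced system,
with `c = coth q`. -/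
structure IsEquilibriumData (M g r Z c : ℝ) : Prop where
  one_lt_M : 1 < M
  g_pos : 0 < g
  r_pos : 0 < r
  Z_ne : Z ≠ 0
  one_lt_c : 1 < c
  ratio : c * (r ^ 2 + 1) = (M * (c ^ 2 - 1) + 2) * r
  balance : Z ^ 2 * (M * c - r) = g

/-- Here `r = v / w` is positive because the interaction is attractive. `ratio` expresses that the
forces on the two particles are opposite and equal in size; `balance` then follows by inserting the
value of the force. -/
theorem IsRelativeEquilibrium.exists_equilibriumData (hG : 0 < G) (hμ₁ : 0 < μ₁) (hμ₂ : 0 < μ₂)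
    (hre : IsRelativeEquilibrium μ₁ μ₂ (gravPotential G μ₁ μ₂) ξ R₁ R₂)
    (hz : IsReducedState μ₁ μ₂ (R₁ t) (R₂ t) (deriv R₁ t) (deriv R₂ t) z) :
    hdist (R₁ t) (R₂ t) = z.2.1 ∧ 0 < z.2.1 ∧ ∃ r Z : ℝ, z = (![0, r * Z, Z], z.2.1, 0) ∧
      IsEquilibriumData (1 + μ₁ / μ₂) (G * μ₁ ^ 2 * μ₂) r Z (coth z.2.1) ∧
      (IsElliptic ξ → r < 1) ∧ (IsHyperbolic ξ → 1 < r) := by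
  obtain ⟨hd, v, w, f, hf, hze, e1, e2, hell, hhyp⟩ := hre.exists_frame_velocity hG hμ₁ hμ₂ hz
  have hq : 0 < z.2.1 := hz.1
  refine ⟨hd, hq, ?_⟩
  generalize z.2.1 = q at *
  have hs : 0 < Real.sinh q := Real.sinh_pos_iff.2 hq
  have hcs := Real.cosh_sq q
  have hc1 := one_lt_coth hq
  set s := Real.sinh q
  set ch := Real.cosh q
  have hU : 0 < G * μ₁ * μ₂ / s ^ 2 := by positivity
  have hwv : 0 < w * v := by
    by_contra h
    nlinarith
  have hw : w ≠ 0 := left_ne_zero_of_mul hwv.ne'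
  have hv : v ≠ 0 := right_ne_zero_of_mul hwv.ne'
  have hr : 0 < v / w := by
    rw [← mul_div_mul_right v w hw, mul_comm v w]
    exact div_pos hwv (mul_self_pos.2 hw)
  have e3 : μ₂ * (f * (w * ch - v * s)) = -(μ₁ * (w * v)) := by rw [e2, e1]
  have hf0 : f ≠ 0 := by
    rintro rfl
    rw [zero_mul, mul_zero] at e3
    have := mul_pos hμ₁ hwv
    linarith
  refine ⟨v / w, -(μ₂ * s * f), ?_, ⟨?_, by positivity, hr, ?_, hc1, ?_, ?_⟩, fun h => ?_,
    fun h => ?_⟩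
  -- Action and reaction, `e3`, make the angular momentum parallel to the fixed vector `(0, v, w)`.
  · rw [hze]
    have : -(μ₁ * v) - μ₂ * ch * f = v / w * -(μ₂ * s * f) := by
      field_simp
      linear_combination -e3
    rw [this]
  · have : 0 < μ₁ / μ₂ := by positivity
    linarith
  · exact neg_ne_zero.2 (mul_ne_zero (mul_pos hμ₂ hs).ne' hf0)
  · rw [coth, hf] at *
    change ch / s * ((v / w) ^ 2 + 1) = ((1 + μ₁ / μ₂) * ((ch / s) ^ 2 - 1) + 2) * (v / w)
    have hD : (ch / s) ^ 2 - 1 = 1 / s ^ 2 := by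
      rw [div_pow, hcs]
      field_simp
      ring
    rw [hD]
    field_simp
    linear_combination (-1) * e3 + (μ₂ * v * w) * hcs
  · change (-(μ₂ * s * f)) ^ 2 * ((1 + μ₁ / μ₂) * (ch / s) - v / w) = G * μ₁ ^ 2 * μ₂
    -- The gravitational constant is eliminated by Newton's equation of the first particle; what
    -- remains, `e5`, is a consequence of `e3` alone.
    have e4 : G * μ₁ ^ 2 * μ₂ = μ₁ ^ 2 * (w * v) * s ^ 2 := by
      have : G * μ₁ * μ₂ = μ₁ * (w * v) * s ^ 2 := by
        rw [e1]
        field_simp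
      linear_combination μ₁ * this
    rw [e4]
    have e5 : μ₂ * f ^ 2 * ((μ₁ + μ₂) * ch * w - μ₂ * s * v) = μ₁ ^ 2 * w ^ 2 * v * s := by
      subst hf
      linear_combination (μ₂ * (v * ch - w * s) - μ₁ * w * s) * e3 +
        μ₁ * μ₂ * w * (v * ch - w * s) * v * hcs
    field_simp
    linear_combination e5
  · have h1 : (v / w) ^ 2 < 1 := by
      rw [div_pow, div_lt_one (by positivity)]
      exact hell h
    nlinarith
  · have h1 : 1 < (v / w) ^ 2 := by
      rw [div_pow, one_lt_div (by positivity)]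
      exact hhyp h
    nlinarith

end RelativeEquilibria

/-! ### Binary quadratic forms and the unstable mode -/

section QuadraticForms

/-- Determinant over trace is a lower bound for the smaller eigenvalue of a positive definite binary
form. -/
theorem exists_pos_le_quadratic {α β γ : ℝ} (hα : 0 < α) (h : β ^ 2 < α * γ) :
    ∃ m > 0, ∀ u e : ℝ, m * (u ^ 2 + e ^ 2) ≤ α * u ^ 2 + 2 * β * u * e + γ * e ^ 2 := by
  have hγ : 0 < γ := by
    by_contra hc
    nlinarith [sq_nonneg β, not_lt.1 hc]
  set m := (α * γ - β ^ 2) / (α + γ) with hm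
  have hm1 : m * (α + γ) = α * γ - β ^ 2 := by
    rw [hm]; field_simp
  have hlt : m < α := by
    rw [hm, div_lt_iff₀ (by positivity)]
    nlinarith [sq_nonneg β]
  refine ⟨m, div_pos (by linarith) (by positivity), fun u e => ?_⟩
  have key : (α - m) * (α * u ^ 2 + 2 * β * u * e + γ * e ^ 2 - m * (u ^ 2 + e ^ 2)) =
      ((α - m) * u + β * e) ^ 2 + m ^ 2 * e ^ 2 := by
    linear_combination (-e ^ 2) * hm1
  have h0 : 0 ≤ (α - m) * (α * u ^ 2 + 2 * β * u * e + γ * e ^ 2 - m * (u ^ 2 + e ^ 2)) := by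
    rw [key]; positivity
  linarith [nonneg_of_mul_nonneg_right h0 (sub_pos.2 hlt)]

/-- A pair of modes of the Hamiltonian system `e' = -T o`, `o' = S e` with `T` positive definite and
`S` indefinite. -/
theorem exists_hyperbolic_mode {k M S₁₁ S₁₂ S₂₂ : ℝ} (hk : 0 < k) (hkM : 1 < k * M)
    (h₁₁ : 0 < S₁₁) (hS : S₁₁ * S₂₂ < S₁₂ ^ 2) :
    ∃ l a₁ a₂ b₁ b₂ : ℝ, 0 < l ∧ k * a₁ - a₂ = -(l * b₁) ∧ -a₁ + M * a₂ = -(l * b₂) ∧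
      S₁₁ * b₁ + S₁₂ * b₂ = l * a₁ ∧ S₁₂ * b₁ + S₂₂ * b₂ = l * a₂ ∧ 0 < b₂ ∧
      a₁ * b₁ + a₂ * b₂ < 0 := by
  set Δ := k * M - 1 with hΔ
  have hΔ0 : 0 < Δ := by linarith
  have hM : 0 < M := by
    by_contra hc
    nlinarith [not_lt.1 hc]
  -- Let `T` have rows `(k, -1)`, `(-1, M)`. Eliminating `a` leaves `(S + L adj T) b = 0` with `L =
  -- l² / Δ`. The determinant of this matrix is `δ + L τ + L² Δ`; as `δ < 0 < Δ`, it has a positive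
  -- root `L`.
  set τ := k * S₁₁ + M * S₂₂ - 2 * S₁₂ with hτ
  set δ := S₁₁ * S₂₂ - S₁₂ ^ 2 with hδ
  have hδ0 : δ < 0 := by linarith
  have hdisc : τ ^ 2 < τ ^ 2 - 4 * Δ * δ := by nlinarith [mul_pos hΔ0 (neg_pos.2 hδ0)]
  set w := √(τ ^ 2 - 4 * Δ * δ)
  have hw2 : w ^ 2 = τ ^ 2 - 4 * Δ * δ := Real.sq_sqrt (by nlinarith [sq_nonneg τ])
  have hwτ : τ < w := lt_of_le_of_lt (le_abs_self τ) (by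
    rw [← Real.sqrt_sq_eq_abs]; exact Real.sqrt_lt_sqrt (sq_nonneg _) hdisc)
  set L := (w - τ) / (2 * Δ) with hL
  have hL0 : 0 < L := div_pos (by linarith) (by positivity)
  have hLeq : δ + L * τ + L ^ 2 * Δ = 0 := by
    rw [hL]
    field_simp
    linear_combination hw2
  set l := √(L * Δ)
  have hl : 0 < l := Real.sqrt_pos.2 (by positivity)
  have hl2 : l ^ 2 = L * Δ := Real.sq_sqrt (by positivity)
  -- `b` is the kernel vector read off from the first row of `S + L adj T`; then `a = S b / l`, and
  -- `a·b < 0` because `adj T` is positive definite.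
  set b₁ := -(S₁₂ + L) with hb₁
  set b₂ := S₁₁ + L * M with hb₂
  have hb₂0 : 0 < b₂ := by positivity
  have r1 : S₁₁ * b₁ + S₁₂ * b₂ = -(L * (M * b₁ + b₂)) := by rw [hb₁, hb₂]; ring
  have r2 : S₁₂ * b₁ + S₂₂ * b₂ = -(L * (b₁ + k * b₂)) := by
    rw [hb₁, hb₂]; linear_combination hLeq
  refine ⟨l, -(L * (M * b₁ + b₂)) / l, -(L * (b₁ + k * b₂)) / l, b₁, b₂, hl, ?_, ?_, ?_, ?_,
    hb₂0, ?_⟩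
  · field_simp
    linear_combination b₁ * hl2
  · field_simp
    linear_combination b₂ * hl2
  · rw [r1]; field_simp
  · rw [r2]; field_simp
  · have : 0 < M * b₁ ^ 2 + 2 * b₁ * b₂ + k * b₂ ^ 2 := by
      have h1 : M * (M * b₁ ^ 2 + 2 * b₁ * b₂ + k * b₂ ^ 2) = (M * b₁ + b₂) ^ 2 + Δ * b₂ ^ 2 := by
        rw [hΔ]; ring
      have h2 : 0 < M * (M * b₁ ^ 2 + 2 * b₁ * b₂ + k * b₂ ^ 2) := by rw [h1]; positivity
      exact (mul_pos_iff_of_pos_left hM).1 h2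
    have h3 : -(L * (M * b₁ + b₂)) / l * b₁ + -(L * (b₁ + k * b₂)) / l * b₂ =
        -(L * (M * b₁ ^ 2 + 2 * b₁ * b₂ + k * b₂ ^ 2) / l) := by
      field_simp
      ring
    rw [h3]
    have : 0 < L * (M * b₁ ^ 2 + 2 * b₁ * b₂ + k * b₂ ^ 2) / l := by positivity
    linarith

/-- The form `S` is negative at `b`, and the kernel of `φ = a·(u, e)` is the `S`-orthogonal
complement of `b`, as `S b = l a`. Hence `S` is positive on that kernel, and a large multiple of
`φ²` makes it positive definite. -/
theorem exists_posDef_add_sq {l a₁ a₂ b₁ b₂ S₁₁ S₁₂ S₂₂ : ℝ} (hl : 0 < l)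
    (h₁₁ : 0 < S₁₁) (hS : S₁₁ * S₂₂ < S₁₂ ^ 2)
    (e₁ : S₁₁ * b₁ + S₁₂ * b₂ = l * a₁) (e₂ : S₁₂ * b₁ + S₂₂ * b₂ = l * a₂)
    (hab : a₁ * b₁ + a₂ * b₂ < 0) :
    ∃ κ : ℝ, 0 < κ ∧ 0 < S₁₁ / 2 + κ * a₁ ^ 2 ∧
      (S₁₂ / 2 + κ * (a₁ * a₂)) ^ 2 < (S₁₁ / 2 + κ * a₁ ^ 2) * (S₂₂ / 2 + κ * a₂ ^ 2) := by
  set X := S₁₁ * a₂ ^ 2 - 2 * S₁₂ * (a₁ * a₂) + S₂₂ * a₁ ^ 2 with hX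
  have hXe : l * X = (S₁₁ * S₂₂ - S₁₂ ^ 2) * (a₁ * b₁ + a₂ * b₂) := by
    rw [hX]
    linear_combination (-(S₂₂ * a₁) + S₁₂ * a₂) * e₁ + (S₁₂ * a₁ - S₁₁ * a₂) * e₂
  have hX0 : 0 < X := by
    have : 0 < l * X := by rw [hXe]; exact mul_pos_of_neg_of_neg (by linarith) hab
    exact (mul_pos_iff_of_pos_left hl).1 this
  have hd : 0 < S₁₂ ^ 2 - S₁₁ * S₂₂ := by linarith
  -- The determinant of `S / 2 + κ a aᵀ` is `det S / 4 + κ X / 2`; this `κ` turns it into `-det S /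
  -- 4 > 0`.
  set κ := (S₁₂ ^ 2 - S₁₁ * S₂₂) / X with hκ
  have hκX : κ * X = S₁₂ ^ 2 - S₁₁ * S₂₂ := by rw [hκ]; field_simp
  have hκ0 : 0 < κ := by positivity
  refine ⟨κ, hκ0, by positivity, ?_⟩
  have : (S₁₁ / 2 + κ * a₁ ^ 2) * (S₂₂ / 2 + κ * a₂ ^ 2) - (S₁₂ / 2 + κ * (a₁ * a₂)) ^ 2 =
      (S₁₁ * S₂₂ - S₁₂ ^ 2) / 4 + κ * X / 2 := by rw [hX]; ring
  rw [hκX] at this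
  linarith

end QuadraticForms

namespace IsEquilibriumData

variable {M g r Z c : ℝ}

section

variable (h : IsEquilibriumData M g r Z c)
include h

theorem c_pos : 0 < c := one_pos.trans h.one_lt_c

theorem D_pos : 0 < c ^ 2 - 1 := by nlinarith [h.one_lt_c]

theorem k_pos : 0 < c / r := div_pos h.c_pos h.r_pos

/-- `balance` with `g > 0` forces `M c > r`. This makes the block `T` of the odd variables positive
definite. -/
theorem one_lt_kM : 1 < c / r * M := by
  have h1 : 0 < M * c - r := by
    by_contra hc
    nlinarith [h.balance, h.g_pos, sq_nonneg Z, not_lt.1 hc]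
  rw [div_mul_eq_mul_div, one_lt_div h.r_pos]
  linarith

end

end IsEquilibriumData

/-! ### The energy-Casimir function near an equilibrium -/

section Deviations

open Filter Topology

/-- Deviations `(x, dy, dz, dc, p)` from the state `(0, r Z, Z, c, 0)`. -/
abbrev Dev := ℝ × ℝ × ℝ × ℝ × ℝ

/-- The square of the Euclidean length of a deviation. -/
def Dev.sq (d : Dev) : ℝ := d.1 ^ 2 + d.2.1 ^ 2 + d.2.2.1 ^ 2 + d.2.2.2.1 ^ 2 + d.2.2.2.2 ^ 2

/-- The first normalized even coordinate of a deviation. -/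
def Dev.u (r Z : ℝ) (d : Dev) : ℝ := (d.2.1 - r * d.2.2.1) / (Z * (1 - r ^ 2))

/-- The second normalized even coordinate of a deviation. -/
def Dev.e (c : ℝ) (d : Dev) : ℝ := d.2.2.2.1 / (c ^ 2 - 1)

/-- The linearized deviation of the Casimir function, up to a factor. -/
def Dev.l (r : ℝ) (d : Dev) : ℝ := d.2.2.1 - r * d.2.1

/-- The deviation of the Casimir function. -/
def Dev.cas (r Z : ℝ) (d : Dev) : ℝ :=
  2 * Z * d.l r + (d.2.2.1 ^ 2 - d.2.1 ^ 2 - d.1 ^ 2)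

/-- The deviation of the energy-Casimir function. -/
def Dev.aug (M g r Z c : ℝ) (d : Dev) : ℝ :=
  energy M g d.1 (r * Z + d.2.1) (Z + d.2.2.1) (c + d.2.2.2.1) d.2.2.2.2 +
    1 / 2 * (c / r - 1) * (d.1 ^ 2 + (r * Z + d.2.1) ^ 2 - (Z + d.2.2.1) ^ 2) -
  (energy M g 0 (r * Z) Z c 0 + 1 / 2 * (c / r - 1) * ((r * Z) ^ 2 - Z ^ 2))

theorem Dev.cas_eq (r Z : ℝ) (d : Dev) :
    d.cas r Z = (Z + d.2.2.1) ^ 2 - (r * Z + d.2.1) ^ 2 - d.1 ^ 2 - (Z ^ 2 - (r * Z) ^ 2) := by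
  unfold Dev.cas Dev.l; ring

/-- The coefficients of the second variation of the energy. -/
def S₁₁ (r Z c : ℝ) : ℝ := c / r * (Z * (1 - r ^ 2)) ^ 2

def S₁₂ (M r Z c : ℝ) : ℝ := Z ^ 2 * (2 * M * c * r - 1 - r ^ 2) * (c ^ 2 - 1)

def S₂₂ (M Z c : ℝ) : ℝ := M * Z ^ 2 * (c ^ 2 - 1) ^ 2

/-- The coefficient that couples the second variation to the Casimir function. -/
def coupling (M r Z c : ℝ) : ℝ := 2 * Z * (c ^ 2 - 1) * (M * c - r) / (1 - r ^ 2)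

/-- Each cubic monomial is a small factor times a quadratic one bounded by `s`; the quartic term is
nonnegative. -/
theorem cubic_bound {M c Z m ρ x dy dz dc p s : ℝ} (hM : 0 < M) (hc : 0 < c)
    (hρC : ρ * (1 + M * c + M * |Z|) = m) (hdc : |dc| < ρ) (hdz : |dz| < ρ)
    (hsqe : s = x ^ 2 + dy ^ 2 + dz ^ 2 + dc ^ 2 + p ^ 2) :
    -(m * s) ≤ -(dc * dy * dz) + M * c * (dc * dz ^ 2) +
      M * Z * (dc ^ 2 * dz) + M / 2 * (dc ^ 2 * dz ^ 2) := by
  have t : ∀ a b : ℝ, |a| < ρ → |b| ≤ s → |a * b| ≤ ρ * s := fun a b ha hb => by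
    rw [abs_mul]; exact mul_le_mul ha.le hb (abs_nonneg _) ((abs_nonneg _).trans ha.le)
  have q1 := (abs_le.1 (t dc (dy * dz) hdc (by
    rw [abs_le, hsqe]
    constructor <;> nlinarith [sq_nonneg x, sq_nonneg (dy - dz), sq_nonneg (dy + dz),
      sq_nonneg dc, sq_nonneg p]))).2
  have q2 := (abs_le.1 (t dc (dz ^ 2) hdc (by
    rw [abs_le, hsqe]
    constructor <;> nlinarith [sq_nonneg x, sq_nonneg dy, sq_nonneg dz,
      sq_nonneg dc, sq_nonneg p]))).1
  have q3 := t dz (dc ^ 2) hdz (by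
    rw [abs_le, hsqe]
    constructor <;> nlinarith [sq_nonneg x, sq_nonneg dy, sq_nonneg dz,
      sq_nonneg dc, sq_nonneg p])
  have q4 : -(M * |Z| * (ρ * s)) ≤ M * Z * (dc ^ 2 * dz) := by
    have h1 : |M * Z * (dc ^ 2 * dz)| ≤ M * |Z| * (ρ * s) := by
      rw [abs_mul, abs_mul, abs_of_pos hM, mul_comm (dc ^ 2)]
      exact mul_le_mul_of_nonneg_left q3 (by positivity)
    exact (abs_le.1 h1).1
  have q5 : 0 ≤ M / 2 * (dc ^ 2 * dz ^ 2) := by positivity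
  have q6 := mul_le_mul_of_nonneg_left q2 (mul_pos hM hc).le
  have q7 : m * s = ρ * s + M * c * (ρ * s) + M * |Z| * (ρ * s) := by
    rw [← hρC]; ring
  linarith

/-- Undoes the linear change of variables from `(dy, dz, dc)` to `(u, e, l)`, which is invertible
because `r² ≠ 1`; `Q` is the sum of the resulting coefficients of `u²`, `l²` and `e²`. -/
theorem even_bound {Z r c Q u e l dy dz dc : ℝ} (hN : 1 - r ^ 2 ≠ 0)
    (hdy : dy = Z * u + r / (1 - r ^ 2) * l) (hdz : dz = Z * r * u + 1 / (1 - r ^ 2) * l)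
    (hdc : dc = (c ^ 2 - 1) * e)
    (hQ : Q = 2 * Z ^ 2 * (1 + r ^ 2) + 2 * (1 + r ^ 2) / (1 - r ^ 2) ^ 2 + (c ^ 2 - 1) ^ 2) :
    dy ^ 2 + dz ^ 2 + dc ^ 2 ≤ Q * (u ^ 2 + e ^ 2 + l ^ 2) := by
  have t1 : ∀ a b : ℝ, (a + b) ^ 2 ≤ 2 * (a ^ 2 + b ^ 2) := fun a b => by
    nlinarith [sq_nonneg (a - b)]
  have h1 : dy ^ 2 + dz ^ 2 + dc ^ 2 ≤ 2 * Z ^ 2 * (1 + r ^ 2) * u ^ 2 +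
      2 * (1 + r ^ 2) / (1 - r ^ 2) ^ 2 * l ^ 2 + (c ^ 2 - 1) ^ 2 * e ^ 2 := by
    have i1 := t1 (Z * u) (r / (1 - r ^ 2) * l)
    have i2 := t1 (Z * r * u) (1 / (1 - r ^ 2) * l)
    rw [← hdy] at i1
    rw [← hdz] at i2
    have i3 : 2 * (1 + r ^ 2) / (1 - r ^ 2) ^ 2 * l ^ 2 =
        2 * ((r / (1 - r ^ 2) * l) ^ 2 + (1 / (1 - r ^ 2) * l) ^ 2) := by
      field_simp
      ring
    rw [i3, hdc]
    linarith
  have p1 : 0 ≤ 2 * Z ^ 2 * (1 + r ^ 2) := by positivity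
  have p2 : 0 ≤ 2 * (1 + r ^ 2) / (1 - r ^ 2) ^ 2 := by positivity
  have p3 : 0 ≤ (c ^ 2 - 1) ^ 2 := by positivity
  refine h1.trans ?_
  have hue : u ^ 2 ≤ u ^ 2 + e ^ 2 + l ^ 2 := by linarith [sq_nonneg e, sq_nonneg l]
  have hle : l ^ 2 ≤ u ^ 2 + e ^ 2 + l ^ 2 := by linarith [sq_nonneg e, sq_nonneg u]
  have hee : e ^ 2 ≤ u ^ 2 + e ^ 2 + l ^ 2 := by linarith [sq_nonneg u, sq_nonneg l]
  rw [hQ, add_mul, add_mul]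
  gcongr

namespace IsEquilibriumData

variable {M g r Z c : ℝ}

theorem S₁₁_pos (h : IsEquilibriumData M g r Z c) (hr : r ^ 2 ≠ 1) : 0 < S₁₁ r Z c := by
  have h1 : Z * (1 - r ^ 2) ≠ 0 := mul_ne_zero h.Z_ne (sub_ne_zero.2 hr.symm)
  have := h.k_pos
  unfold S₁₁
  positivity

/-- The Casimir multiplier `c / r - 1` and the two equilibrium equations cancel the linear terms.
The quadratic part separates `(x, p)` from `(u, e, l)`, and `l` enters only through its product with
`e`. -/
theorem aug_eq (h : IsEquilibriumData M g r Z c) (hr : r ^ 2 ≠ 1) (d : Dev) :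
    d.aug M g r Z c =
      1 / 2 * (c / r * d.1 ^ 2 - 2 * d.1 * d.2.2.2.2 + M * d.2.2.2.2 ^ 2) +
      1 / 2 * (S₁₁ r Z c * d.u r Z ^ 2 + 2 * S₁₂ M r Z c * d.u r Z * d.e c +
        S₂₂ M Z c * d.e c ^ 2) + coupling M r Z c * d.e c * d.l r +
      (-(d.2.2.2.1 * d.2.1 * d.2.2.1) + M * c * (d.2.2.2.1 * d.2.2.1 ^ 2) +
        M * Z * (d.2.2.2.1 ^ 2 * d.2.2.1) + M / 2 * (d.2.2.2.1 ^ 2 * d.2.2.1 ^ 2)) := by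
  obtain ⟨x, dy, dz, dc, p⟩ := d
  have hZ := h.Z_ne
  have hr0 := h.r_pos.ne'
  have hN : 1 - r ^ 2 ≠ 0 := sub_ne_zero.2 hr.symm
  have hD := h.D_pos.ne'
  unfold Dev.aug energy Dev.u Dev.e Dev.l S₁₁ S₁₂ S₂₂ coupling
  simp only
  have e1 : c / r * (Z * (1 - r ^ 2)) ^ 2 * ((dy - r * dz) / (Z * (1 - r ^ 2))) ^ 2 =
      c / r * (dy - r * dz) ^ 2 := by
    field_simp
  have e2 : 2 * (Z ^ 2 * (2 * M * c * r - 1 - r ^ 2) * (c ^ 2 - 1)) *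
      ((dy - r * dz) / (Z * (1 - r ^ 2))) * (dc / (c ^ 2 - 1)) =
      2 * (Z * (2 * M * c * r - 1 - r ^ 2) * (dy - r * dz) / (1 - r ^ 2) * dc) := by
    field_simp
  have e3 : M * Z ^ 2 * (c ^ 2 - 1) ^ 2 * (dc / (c ^ 2 - 1)) ^ 2 = M * Z ^ 2 * dc ^ 2 := by
    field_simp
  have e4 : 2 * Z * (c ^ 2 - 1) * (M * c - r) / (1 - r ^ 2) * (dc / (c ^ 2 - 1)) * (dz - r * dy) =
      2 * Z * (M * c - r) * (dz - r * dy) / (1 - r ^ 2) * dc := by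
    field_simp
  -- Decomposing the factor of `dc` along `dy - r dz` and `dz - r dy` is what determines `S₁₂` and
  -- `coupling`.
  have e5 : Z * (2 * M * c * r - 1 - r ^ 2) * (dy - r * dz) / (1 - r ^ 2) +
      2 * Z * (M * c - r) * (dz - r * dy) / (1 - r ^ 2) =
      -(Z * dy) + (2 * M * c * Z - r * Z) * dz := by
    field_simp
    ring
  rw [e1, e2, e3, e4]
  have e6 : M * (c ^ 2 - 1) + 2 = c / r * (r ^ 2 + 1) := by
    rw [div_mul_eq_mul_div, eq_div_iff hr0, ← h.ratio]
  have e7 : c / r * r = c := div_mul_cancel₀ c hr0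
  generalize c / r = k at *
  linear_combination (Z * dz + dz ^ 2 / 2) * e6 + dc * h.balance - dc * e5 +
    (Z * dy + dy * dz + Z * r * dz) * e7

/-- The energy-Casimir function, complemented by squares, is coercive. -/
theorem coercive (h : IsEquilibriumData M g r Z c) (hr : r ^ 2 ≠ 1) {κ a₁ a₂ : ℝ}
    (hα : 0 < S₁₁ r Z c / 2 + κ * a₁ ^ 2)
    (hαγ : (S₁₂ M r Z c / 2 + κ * (a₁ * a₂)) ^ 2 <
      (S₁₁ r Z c / 2 + κ * a₁ ^ 2) * (S₂₂ M Z c / 2 + κ * a₂ ^ 2)) :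
    ∃ m K : ℝ, 0 < m ∧ ∀ᶠ d : Dev in 𝓝 0,
      m * d.sq ≤ d.aug M g r Z c + κ * (a₁ * d.u r Z + a₂ * d.e c) ^ 2 + K * d.cas r Z ^ 2 := by
  have hZ := h.Z_ne
  have hM : 0 < M := one_pos.trans h.one_lt_M
  have hc := h.c_pos
  have hN : 1 - r ^ 2 ≠ 0 := sub_ne_zero.2 hr.symm
  have hD := h.D_pos
  obtain ⟨m₁, hm₁, hodd⟩ := exists_pos_le_quadratic (α := c / r / 2) (β := -1 / 2) (γ := M / 2)
    (half_pos h.k_pos) (by nlinarith [h.one_lt_kM])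
  obtain ⟨m₂, hm₂, heven⟩ := exists_pos_le_quadratic hα hαγ
  set B := coupling M r Z c with hB
  -- Completing the square in `B e l` costs `m₂ / 2 * e²` and `B² / (2 m₂) * l²`. To leading order
  -- `cas` is `2 Z l`, and this `K` makes `K cas²` pay for the latter and leave `m₂ l²`, up to terms
  -- of fourth order.
  set K := (B ^ 2 / (2 * m₂) + m₂) / (2 * Z ^ 2) with hK
  have hKpos : 0 < K := by positivity
  have hKZ : K * (2 * Z ^ 2) = B ^ 2 / (2 * m₂) + m₂ := by
    rw [hK]; field_simp
  set Q := 2 * Z ^ 2 * (1 + r ^ 2) + 2 * (1 + r ^ 2) / (1 - r ^ 2) ^ 2 + (c ^ 2 - 1) ^ 2 with hQ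
  have hQpos : 0 < Q := by positivity
  set m₃ := m₂ / 2 / Q with hm₃
  have hm₃pos : 0 < m₃ := by positivity
  set m₀ := min m₁ m₃
  have hm₀ : 0 < m₀ := lt_min hm₁ hm₃pos
  have hm₀₁ : m₀ ≤ m₁ := min_le_left _ _
  have hm₀₃ : m₀ ≤ m₃ := min_le_right _ _
  set C := 1 + M * c + M * |Z| with hC
  have hCpos : 0 < C := by positivity
  refine ⟨m₀ / 2, K, half_pos hm₀, ?_⟩
  have hsmall : ∀ᶠ d : Dev in 𝓝 0, |d.2.2.2.1| < m₀ / 4 / C ∧ |d.2.2.1| < m₀ / 4 / C ∧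
      d.sq < m₀ / 4 / K := by
    have c1 : Continuous fun d : Dev => |d.2.2.2.1| := by fun_prop
    have c2 : Continuous fun d : Dev => |d.2.2.1| := by fun_prop
    have c3 : Continuous fun d : Dev => d.sq := by unfold Dev.sq; fun_prop
    refine (c1.continuousAt.eventually (gt_mem_nhds ?_)).and
      ((c2.continuousAt.eventually (gt_mem_nhds ?_)).and
        (c3.continuousAt.eventually (gt_mem_nhds ?_)))
    · simp; positivity
    · simp; positivity
    · simp [Dev.sq]; positivity
  filter_upwards [hsmall] with d ⟨hdc, hdz, hsq⟩
  rw [h.aug_eq hr, ← hB]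
  have hdy' : d.2.1 = Z * d.u r Z + r / (1 - r ^ 2) * d.l r := by
    unfold Dev.u Dev.l; field_simp; ring
  have hdz' : d.2.2.1 = Z * r * d.u r Z + 1 / (1 - r ^ 2) * d.l r := by
    unfold Dev.u Dev.l; field_simp; ring
  have hdc' : d.2.2.2.1 = (c ^ 2 - 1) * d.e c := by
    unfold Dev.e; field_simp
  have hcas : d.cas r Z = 2 * Z * d.l r + (d.2.2.1 ^ 2 - d.2.1 ^ 2 - d.1 ^ 2) := rfl
  have hsqe : d.sq = d.1 ^ 2 + d.2.1 ^ 2 + d.2.2.1 ^ 2 + d.2.2.2.1 ^ 2 + d.2.2.2.2 ^ 2 := rfl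
  have ho := hodd d.1 d.2.2.2.2
  have he := heven (d.u r Z) (d.e c)
  clear_value K Q m₃ m₀ C B
  generalize d.u r Z = u at *
  generalize d.e c = e at *
  generalize d.l r = l at *
  generalize d.cas r Z = C' at *
  generalize d.sq = s at *
  obtain ⟨x, dy, dz, dc, p⟩ := d
  simp only at *
  -- the even variables are controlled by `u`, `e`, `l`
  have hQle := even_bound (Z := Z) (r := r) hN hdy' hdz' hdc' hQ
  have hm₃le : m₃ * (dy ^ 2 + dz ^ 2 + dc ^ 2) ≤ m₂ / 2 * (u ^ 2 + e ^ 2 + l ^ 2) := by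
    have := mul_le_mul_of_nonneg_left hQle hm₃pos.le
    have h2 : m₃ * Q = m₂ / 2 := by rw [hm₃]; field_simp
    rwa [← mul_assoc, h2] at this
  -- the coupling term and the Casimir function
  have hcoup : -(m₂ / 2 * e ^ 2) - B ^ 2 / (2 * m₂) * l ^ 2 ≤ B * e * l := by
    have h1 : B * e * l + (m₂ / 2 * e ^ 2 + B ^ 2 / (2 * m₂) * l ^ 2) =
        (m₂ * e + B * l) ^ 2 / (2 * m₂) := by
      field_simp
      ring
    have h2 : 0 ≤ (m₂ * e + B * l) ^ 2 / (2 * m₂) := by positivity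
    linarith
  set w := dz ^ 2 - dy ^ 2 - x ^ 2 with hw
  have hcasle : (B ^ 2 / (2 * m₂) + m₂) * l ^ 2 - K * w ^ 2 ≤ K * C' ^ 2 := by
    rw [← hKZ, hcas]
    have h1 : K * (2 * Z * l + w) ^ 2 - (K * (2 * Z ^ 2) * l ^ 2 - K * w ^ 2) =
        K * (2 * (Z * l + w) ^ 2) := by ring
    have h2 : 0 ≤ K * (2 * (Z * l + w) ^ 2) := by positivity
    linarith
  have hs0 : 0 ≤ s := by rw [hsqe]; positivity
  have hwle : K * w ^ 2 ≤ m₀ / 4 * s := by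
    have h1 : |w| ≤ s := by
      rw [abs_le, hsqe, hw]
      constructor <;> linarith [sq_nonneg x, sq_nonneg dy, sq_nonneg dz, sq_nonneg dc, sq_nonneg p]
    have h2 : w ^ 2 ≤ s ^ 2 := by
      rw [← sq_abs]; exact pow_le_pow_left₀ (abs_nonneg _) h1 2
    have h3 : K * s ≤ m₀ / 4 := by
      rw [lt_div_iff₀ hKpos] at hsq
      linarith
    calc K * w ^ 2 ≤ K * s ^ 2 := mul_le_mul_of_nonneg_left h2 hKpos.le
      _ = K * s * s := by ring
      _ ≤ m₀ / 4 * s := mul_le_mul_of_nonneg_right h3 hs0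
  -- the cubic terms
  have hcub := cubic_bound (m := m₀ / 4) (Z := Z) hM hc (by rw [hC]; field_simp) hdc hdz hsqe
  have hm₁le : m₀ * (x ^ 2 + p ^ 2) ≤ m₁ * (x ^ 2 + p ^ 2) :=
    mul_le_mul_of_nonneg_right hm₀₁ (by positivity)
  have hm₃le' : m₀ * (dy ^ 2 + dz ^ 2 + dc ^ 2) ≤ m₃ * (dy ^ 2 + dz ^ 2 + dc ^ 2) :=
    mul_le_mul_of_nonneg_right hm₀₃ (by positivity)
  have hu0 : 0 ≤ m₂ / 2 * u ^ 2 := by positivity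
  have hl0 : 0 ≤ m₂ / 2 * l ^ 2 := by positivity
  have hsplit : m₀ * s = m₀ * (x ^ 2 + p ^ 2) + m₀ * (dy ^ 2 + dz ^ 2 + dc ^ 2) := by
    rw [hsqe]; ring
  linarith

end IsEquilibriumData

end Deviations

/-! ### Growth of `φ ψ` on the set of nonpositive relative energy -/

section Growth

open Filter Topology

/-- The derivative of `a₁ u + a₂ e` along the reduced vector field, multiplied by `μ₁`. -/
def Dev.evenRate (M r Z c a₁ a₂ : ℝ) (d : Dev) : ℝ :=
  a₁ * ((fieldY M d.1 (r * Z + d.2.1) (Z + d.2.2.1) (c + d.2.2.2.1) d.2.2.2.2 -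
    r * fieldZ d.1 (r * Z + d.2.1) (Z + d.2.2.1) (c + d.2.2.2.1) d.2.2.2.2) / (Z * (1 - r ^ 2))) +
  a₂ * ((1 - (c + d.2.2.2.1) ^ 2) * (M * d.2.2.2.2 - d.1) / (c ^ 2 - 1))

/-- The derivative of `b₁ x + b₂ p` along the reduced vector field, multiplied by `μ₁`. -/
def Dev.oddRate (M g r Z c b₁ b₂ : ℝ) (d : Dev) : ℝ :=
  b₁ * fieldX M (r * Z + d.2.1) (Z + d.2.2.1) (c + d.2.2.2.1) +
  b₂ * fieldP M g (r * Z + d.2.1) (Z + d.2.2.1) (c + d.2.2.2.1)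

theorem eventually_abs_le {f : Dev → ℝ} (hf : Continuous f) (h0 : f 0 = 0) {η : ℝ} (hη : 0 < η) :
    ∀ᶠ d in 𝓝 0, |f d| ≤ η := by
  have : ∀ᶠ d in 𝓝 0, |f d| < η :=
    hf.abs.continuousAt.eventually (gt_mem_nhds (by
      change |f 0| < η
      rwa [h0, abs_zero]))
  filter_upwards [this] with d hd using hd.le

namespace IsEquilibriumData

variable {M g r Z c : ℝ}

/-- To first order `u' = p - (c / r) x` and `e' = x - M p`, so `T a = -l b` gives `φ' = l ψ`. Every
remainder term contains `x` or `p` with a coefficient vanishing at the equilibrium. -/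
theorem evenRate_eq (h : IsEquilibriumData M g r Z c) (hr : r ^ 2 ≠ 1) {l a₁ a₂ b₁ b₂ : ℝ}
    (e₁ : c / r * a₁ - a₂ = -(l * b₁)) (e₂ : -a₁ + M * a₂ = -(l * b₂)) :
    ∃ A₁ A₂ : Dev → ℝ, Continuous A₁ ∧ Continuous A₂ ∧ A₁ 0 = 0 ∧ A₂ 0 = 0 ∧
      ∀ d : Dev, d.evenRate M r Z c a₁ a₂ =
        l * (b₁ * d.1 + b₂ * d.2.2.2.2) + (d.1 * A₁ d + d.2.2.2.2 * A₂ d) := by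
  have hZ := h.Z_ne
  have hr0 := h.r_pos.ne'
  have hN : 1 - r ^ 2 ≠ 0 := sub_ne_zero.2 hr.symm
  have hD := h.D_pos.ne'
  refine ⟨fun d => a₁ / (Z * (1 - r ^ 2)) * (-(M * (c ^ 2 - 1) + 2) * d.2.2.1 -
        M * (2 * c * d.2.2.2.1 + d.2.2.2.1 ^ 2) * (Z + d.2.2.1) + c * d.2.1 +
        d.2.2.2.1 * (r * Z + d.2.1) - r * (-c * d.2.2.1 - d.2.2.2.1 * Z - d.2.2.2.1 * d.2.2.1)) +
        a₂ / (c ^ 2 - 1) * (2 * c * d.2.2.2.1 + d.2.2.2.1 ^ 2),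
    fun d => a₁ / (Z * (1 - r ^ 2)) * (d.2.2.1 - r * d.2.1) -
        a₂ / (c ^ 2 - 1) * (M * (2 * c * d.2.2.2.1 + d.2.2.2.1 ^ 2)),
    by fun_prop, by fun_prop, by simp, by simp, ?_⟩
  rintro ⟨x, dy, dz, dc, p⟩
  unfold Dev.evenRate
  simp only
  have e6 : M * (c ^ 2 - 1) + 2 = c / r * (r ^ 2 + 1) := by
    rw [div_mul_eq_mul_div, eq_div_iff hr0, ← h.ratio]
  have e7 : c / r * r = c := div_mul_cancel₀ c hr0
  have e8 : fieldY M x (r * Z + dy) (Z + dz) (c + dc) p -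
      r * fieldZ x (r * Z + dy) (Z + dz) (c + dc) p = Z * (1 - r ^ 2) * (p - c / r * x) +
      (x * (-(M * (c ^ 2 - 1) + 2) * dz -
        M * (2 * c * dc + dc ^ 2) * (Z + dz) + c * dy +
        dc * (r * Z + dy) - r * (-c * dz - dc * Z - dc * dz)) + p * (dz - r * dy)) := by
    unfold fieldY fieldZ
    linear_combination (-x * Z) * e6 + (-2 * x * Z * r) * e7
  have e9 : (1 - (c + dc) ^ 2) * (M * p - x) = -((c ^ 2 - 1) * (M * p - x)) -
      (2 * c * dc + dc ^ 2) * (M * p - x) := by ring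
  rw [e8, e9, add_div, sub_div, mul_div_cancel_left₀ _ (mul_ne_zero hZ hN), neg_div,
    mul_div_cancel_left₀ _ hD]
  linear_combination (-x) * e₁ + (-p) * e₂

/-- To first order `(x, p)'` is `S (u, e)` plus a multiple of `l` in `p'`. On the Casimir level `l`
equals a quadratic expression, so this term joins the remainder, and `S b = l a` gives `ψ' = l φ`.
-/
theorem oddRate_eq (h : IsEquilibriumData M g r Z c) (hr : r ^ 2 ≠ 1) {l a₁ a₂ b₁ b₂ : ℝ}
    (e₁ : S₁₁ r Z c * b₁ + S₁₂ M r Z c * b₂ = l * a₁)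
    (e₂ : S₁₂ M r Z c * b₁ + S₂₂ M Z c * b₂ = l * a₂) :
    ∃ B₁ B₂ B₃ B₄ : Dev → ℝ, Continuous B₁ ∧ Continuous B₂ ∧ Continuous B₃ ∧ Continuous B₄ ∧
      B₁ 0 = 0 ∧ B₂ 0 = 0 ∧ B₃ 0 = 0 ∧ B₄ 0 = 0 ∧
      ∀ d : Dev, d.cas r Z = 0 → d.oddRate M g r Z c b₁ b₂ =
        l * (a₁ * d.u r Z + a₂ * d.e c) +
          (d.1 * B₁ d + d.2.1 * B₂ d + d.2.2.1 * B₃ d + d.2.2.2.1 * B₄ d) := by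
  have hZ := h.Z_ne
  have hr0 := h.r_pos.ne'
  have hN : 1 - r ^ 2 ≠ 0 := sub_ne_zero.2 hr.symm
  have hD := h.D_pos.ne'
  set B := coupling M r Z c with hB
  set E := M * (c ^ 2 - 1) + 2 with hE
  refine ⟨fun d => b₂ * B / (2 * Z) * d.1,
    fun d => b₂ * B / (2 * Z) * d.2.1 + b₁ * (-c * d.2.1 - 2 * (r * Z) * d.2.2.2.1 -
      d.2.2.2.1 * d.2.1 + E * d.2.2.1 + 2 * M * c * Z * d.2.2.2.1 +
      2 * M * c * d.2.2.2.1 * d.2.2.1 + M * d.2.2.2.1 ^ 2 * (Z + d.2.2.1)),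
    fun d => -(b₂ * B / (2 * Z) * d.2.2.1) + b₁ * (2 * M * c * (r * Z) * d.2.2.2.1 +
      M * d.2.2.2.1 ^ 2 * (r * Z) - c * d.2.2.1 - 2 * Z * d.2.2.2.1 - d.2.2.2.1 * d.2.2.1) +
      b₂ * ((c ^ 2 - 1) * (M * c * d.2.2.1 + M * d.2.2.2.1 * (2 * Z + d.2.2.1) - d.2.1)),
    fun d => b₁ * (M * d.2.2.2.1 * (r * Z) * Z) + b₂ * ((2 * c + d.2.2.2.1) *
      (-(Z * d.2.1) + (2 * M * c * Z - r * Z) * d.2.2.1 + M * Z ^ 2 * d.2.2.2.1 +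
      d.2.2.1 * (M * c * d.2.2.1 + M * d.2.2.2.1 * (2 * Z + d.2.2.1) - d.2.1))),
    by fun_prop, by fun_prop, by fun_prop, by fun_prop, by simp, by simp, by simp, by simp, ?_⟩
  rintro ⟨x, dy, dz, dc, p⟩ hcas
  unfold Dev.oddRate
  unfold Dev.cas at hcas
  simp only at hcas ⊢
  have e6 : E = c / r * (r ^ 2 + 1) := by
    rw [div_mul_eq_mul_div, eq_div_iff hr0, ← h.ratio]
  have e7 : c / r * r = c := div_mul_cancel₀ c hr0
  have hS1 : S₁₁ r Z c * Dev.u r Z (x, dy, dz, dc, p) + S₁₂ M r Z c * Dev.e c (x, dy, dz, dc, p) =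
      c / r * (Z * (1 - r ^ 2)) * (dy - r * dz) + Z ^ 2 * (2 * M * c * r - 1 - r ^ 2) * dc := by
    unfold S₁₁ S₁₂ Dev.u Dev.e
    field_simp
  have hS2 : S₁₂ M r Z c * Dev.u r Z (x, dy, dz, dc, p) + S₂₂ M Z c * Dev.e c (x, dy, dz, dc, p) +
      B * Dev.l r (x, dy, dz, dc, p) =
      (c ^ 2 - 1) * (-(Z * dy) + (2 * M * c * Z - r * Z) * dz + M * Z ^ 2 * dc) := by
    rw [hB]
    unfold S₁₂ S₂₂ Dev.u Dev.e Dev.l coupling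
    field_simp
    ring
  have hl : B * Dev.l r (x, dy, dz, dc, p) = B / (2 * Z) * (x * x + dy * dy - dz * dz) := by
    field_simp
    linear_combination B * hcas
  have hX : fieldX M (r * Z + dy) (Z + dz) (c + dc) =
      c / r * (Z * (1 - r ^ 2)) * (dy - r * dz) + Z ^ 2 * (2 * M * c * r - 1 - r ^ 2) * dc +
      (dy * (-c * dy - 2 * (r * Z) * dc -
      dc * dy + E * dz + 2 * M * c * Z * dc +
      2 * M * c * dc * dz + M * dc ^ 2 * (Z + dz)) + dz * (2 * M * c * (r * Z) * dc +
      M * dc ^ 2 * (r * Z) - c * dz - 2 * Z * dc - dc * dz) + dc * (M * dc * (r * Z) * Z)) := by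
    have : fieldX M (r * Z + dy) (Z + dz) (c + dc) = -(c + dc) * (r * Z + dy) ^ 2 +
      (E + M * (2 * c * dc + dc ^ 2)) * (r * Z + dy) * (Z + dz) - (c + dc) * (Z + dz) ^ 2 := by
      rw [hE]; unfold fieldX; ring
    rw [this]
    linear_combination (r * Z ^ 2 + Z * dy + r * Z * dz) * e6 +
      (Z ^ 2 * (r ^ 2 + 1) + 2 * Z * r * dy + 2 * Z * dz) * e7
  have hP : fieldP M g (r * Z + dy) (Z + dz) (c + dc) =
      (c ^ 2 - 1) * (-(Z * dy) + (2 * M * c * Z - r * Z) * dz + M * Z ^ 2 * dc) +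
      (dz * ((c ^ 2 - 1) * (M * c * dz + M * dc * (2 * Z + dz) - dy)) +
      dc * ((2 * c + dc) * (-(Z * dy) + (2 * M * c * Z - r * Z) * dz + M * Z ^ 2 * dc +
      dz * (M * c * dz + M * dc * (2 * Z + dz) - dy)))) := by
    unfold fieldP
    linear_combination ((c + dc) ^ 2 - 1) * h.balance
  rw [hX, hP, ← hS1, ← hS2, hl]
  linear_combination Dev.u r Z (x, dy, dz, dc, p) * e₁ + Dev.e c (x, dy, dz, dc, p) * e₂

/-- With `cas = 0` and `aug ≤ 0`, coercivity bounds the entire deviation by a multiple of `|φ|`. The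
remainders are therefore small compared with `φ`, and the leading part `l (φ² + ψ²)` of the
derivative of `φ ψ` prevails. -/
theorem growth (h : IsEquilibriumData M g r Z c) (hr : r ^ 2 ≠ 1) {l a₁ a₂ b₁ b₂ κ m K : ℝ}
    (hl : 0 < l) (e₁ : c / r * a₁ - a₂ = -(l * b₁)) (e₂ : -a₁ + M * a₂ = -(l * b₂))
    (e₃ : S₁₁ r Z c * b₁ + S₁₂ M r Z c * b₂ = l * a₁)
    (e₄ : S₁₂ M r Z c * b₁ + S₂₂ M Z c * b₂ = l * a₂) (hκ : 0 < κ) (hm : 0 < m)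
    (hco : ∀ᶠ d : Dev in 𝓝 0,
      m * d.sq ≤ d.aug M g r Z c + κ * (a₁ * d.u r Z + a₂ * d.e c) ^ 2 + K * d.cas r Z ^ 2) :
    ∀ᶠ d : Dev in 𝓝 0, d.cas r Z = 0 → d.aug M g r Z c ≤ 0 →
      l / 2 * ((a₁ * d.u r Z + a₂ * d.e c) * (b₁ * d.1 + b₂ * d.2.2.2.2)) ≤
        d.evenRate M r Z c a₁ a₂ * (b₁ * d.1 + b₂ * d.2.2.2.2) +
        (a₁ * d.u r Z + a₂ * d.e c) * d.oddRate M g r Z c b₁ b₂ := by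
  obtain ⟨A₁, A₂, hA₁, hA₂, hA₁0, hA₂0, hA⟩ := h.evenRate_eq hr e₁ e₂
  obtain ⟨B₁, B₂, B₃, B₄, hB₁, hB₂, hB₃, hB₄, hB₁0, hB₂0, hB₃0, hB₄0, hB⟩ := h.oddRate_eq hr e₃ e₄
  set κ' := √(κ / m) with hκ'
  have hκ'0 : 0 < κ' := Real.sqrt_pos.2 (by positivity)
  have hκ'2 : m * κ' ^ 2 = κ := by
    rw [hκ', Real.sq_sqrt (by positivity)]; field_simp
  -- With `|d| ≤ κ' |φ|`, each remainder term is at most `l / 8 * |φ|`: there are two in the even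
  -- rate and four in the odd rate.
  set η := l / (8 * κ') with hη
  have hη0 : 0 < η := by positivity
  have hηκ : η * κ' = l / 8 := by rw [hη]; field_simp
  filter_upwards [hco, eventually_abs_le hA₁ hA₁0 hη0, eventually_abs_le hA₂ hA₂0 hη0,
    eventually_abs_le hB₁ hB₁0 hη0, eventually_abs_le hB₂ hB₂0 hη0,
    eventually_abs_le hB₃ hB₃0 hη0, eventually_abs_le hB₄ hB₄0 hη0] with
    d hd k₁ k₂ k₃ k₄ k₅ k₆ hcas haug
  rw [hA d, hB d hcas]
  set φ := a₁ * d.u r Z + a₂ * d.e c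
  set ψ := b₁ * d.1 + b₂ * d.2.2.2.2
  set n := κ' * |φ| with hn
  have hsq : d.sq ≤ n ^ 2 := by
    rw [hcas] at hd
    have : m * d.sq ≤ m * n ^ 2 := by
      rw [hn, mul_pow, sq_abs, ← mul_assoc, hκ'2]
      linarith
    exact le_of_mul_le_mul_left this hm
  have hn0 : 0 ≤ n := by positivity
  have hsqe : d.sq = d.1 ^ 2 + d.2.1 ^ 2 + d.2.2.1 ^ 2 + d.2.2.2.1 ^ 2 + d.2.2.2.2 ^ 2 := rfl
  have hcomp : ∀ a b : ℝ, a ^ 2 ≤ d.sq → |b| ≤ η → |a * b| ≤ l / 8 * |φ| := fun a b ha hb => by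
    have h1 : |a| ≤ n := abs_le_of_sq_le_sq (ha.trans hsq) hn0
    calc |a * b| = |a| * |b| := abs_mul a b
      _ ≤ n * η := mul_le_mul h1 hb (abs_nonneg _) hn0
      _ = l / 8 * |φ| := by rw [hn, ← hηκ]; ring
  have n1 := sq_nonneg d.1
  have n2 := sq_nonneg d.2.1
  have n3 := sq_nonneg d.2.2.1
  have n4 := sq_nonneg d.2.2.2.1
  have n5 := sq_nonneg d.2.2.2.2
  have s1 : d.1 ^ 2 ≤ d.sq := by rw [hsqe]; linarith
  have s2 : d.2.1 ^ 2 ≤ d.sq := by rw [hsqe]; linarith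
  have s3 : d.2.2.1 ^ 2 ≤ d.sq := by rw [hsqe]; linarith
  have s4 : d.2.2.2.1 ^ 2 ≤ d.sq := by rw [hsqe]; linarith
  have s5 : d.2.2.2.2 ^ 2 ≤ d.sq := by rw [hsqe]; linarith
  have c1 := hcomp _ _ s1 k₁
  have c2 := hcomp _ _ s5 k₂
  have c3 := hcomp _ _ s1 k₃
  have c4 := hcomp _ _ s2 k₄
  have c5 := hcomp _ _ s3 k₅
  have c6 := hcomp _ _ s4 k₆
  set R₁ := d.1 * A₁ d + d.2.2.2.2 * A₂ d
  set R₂ := d.1 * B₁ d + d.2.1 * B₂ d + d.2.2.1 * B₃ d + d.2.2.2.1 * B₄ d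
  have hR₁ : |R₁| ≤ l / 4 * |φ| := by
    have := abs_add_le (d.1 * A₁ d) (d.2.2.2.2 * A₂ d)
    linarith
  have hR₂ : |R₂| ≤ l / 2 * |φ| := by
    have t1 := abs_add_le (d.1 * B₁ d + d.2.1 * B₂ d + d.2.2.1 * B₃ d) (d.2.2.2.1 * B₄ d)
    have t2 := abs_add_le (d.1 * B₁ d + d.2.1 * B₂ d) (d.2.2.1 * B₃ d)
    have t3 := abs_add_le (d.1 * B₁ d) (d.2.1 * B₂ d)
    linarith
  have q1 : -(l / 4 * (|φ| * |ψ|)) ≤ R₁ * ψ := by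
    have : |R₁ * ψ| ≤ l / 4 * (|φ| * |ψ|) := by
      rw [abs_mul, ← mul_assoc]
      exact mul_le_mul_of_nonneg_right hR₁ (abs_nonneg _)
    exact (abs_le.1 this).1
  have q2 : -(l / 2 * (|φ| * |φ|)) ≤ φ * R₂ := by
    have : |φ * R₂| ≤ l / 2 * (|φ| * |φ|) := by
      rw [mul_comm, abs_mul, ← mul_assoc]
      exact mul_le_mul_of_nonneg_right hR₂ (abs_nonneg _)
    exact (abs_le.1 this).1
  have q3 : φ * ψ ≤ |φ| * |ψ| := by rw [← abs_mul]; exact le_abs_self _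
  have q4 : |φ| * |φ| = φ ^ 2 := by rw [← sq, sq_abs]
  have q5 : |ψ| * |ψ| = ψ ^ 2 := by rw [← sq, sq_abs]
  have q6 : 0 ≤ l * (|φ| - |ψ|) ^ 2 := by positivity
  have q7 : 0 ≤ l * ψ ^ 2 := by positivity
  have q8 : l * (φ * ψ) ≤ l * (|φ| * |ψ|) := mul_le_mul_of_nonneg_left q3 hl.le
  have q9 : l * (|φ| - |ψ|) ^ 2 = l * φ ^ 2 + l * ψ ^ 2 - 2 * (l * (|φ| * |ψ|)) := by
    rw [← q4, ← q5]; ring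
  have q10 : 0 ≤ l * (|φ| * |ψ|) := by positivity
  rw [q4] at q2
  linarith

end IsEquilibriumData

end Growth

/-! ### Conservation laws and nonlinear stability -/

section Flow

open Filter Topology Set

/-- The deviation of a reduced state from `((0, r Z, Z), arcoth c, 0)`. -/
def devOf (r Z c : ℝ) (z : RedVec) : Dev :=
  (z.1 0, z.1 1 - r * Z, z.1 2 - Z, coth z.2.1 - c, z.2.2)

theorem continuousAt_devOf (r Z c : ℝ) {z : RedVec} (hz : z ∈ redSpace) :
    ContinuousAt (devOf r Z c) z := by
  have hc : ContinuousAt (fun z : RedVec => coth z.2.1) z :=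
    ContinuousAt.comp (f := fun z : RedVec => z.2.1) (hasDerivAt_coth hz).continuousAt
      (by fun_prop)
  unfold devOf
  fun_prop

theorem coth_injOn : InjOn coth (Ioi 0) := by
  intro a ha b hb hab
  have hsa : Real.sinh a ≠ 0 := (Real.sinh_pos_iff.2 ha).ne'
  have hsb : Real.sinh b ≠ 0 := (Real.sinh_pos_iff.2 hb).ne'
  rw [coth, coth, div_eq_div_iff hsa hsb] at hab
  have : Real.sinh (a - b) = 0 := by rw [Real.sinh_sub]; linarith
  linarith [Real.sinh_eq_zero.1 this]

theorem casimir_eq (z : RedVec) : casimir z = z.1 2 ^ 2 - z.1 1 ^ 2 - z.1 0 ^ 2 := by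
  rw [casimir, mink_eq]; ring

/-- The energy of a reduced state, multiplied by `μ₁`. -/
def stateEnergy (M g : ℝ) (z : RedVec) : ℝ :=
  energy M g (z.1 0) (z.1 1) (z.1 2) (coth z.2.1) z.2.2

theorem hasDerivWithinAt_energy (M g : ℝ) {x y z c p : ℝ → ℝ} {x' y' z' c' p' t : ℝ} {s : Set ℝ}
    (hx : HasDerivWithinAt x x' s t) (hy : HasDerivWithinAt y y' s t)
    (hz : HasDerivWithinAt z z' s t) (hc : HasDerivWithinAt c c' s t)
    (hp : HasDerivWithinAt p p' s t) :
    HasDerivWithinAt (fun t => energy M g (x t) (y t) (z t) (c t) (p t))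
      (x' * (x t - p t) + y' * (y t - c t * z t) +
        z' * (-(c t * y t) + (M * (c t ^ 2 - 1) + 1) * z t) +
        c' * (-(y t * z t) + M * c t * z t ^ 2 - g) + p' * (M * p t - x t)) s t := by
  have h1 := ((hx.pow 2).add (hy.pow 2)).sub (((hc.const_mul 2).mul hy).mul hz)
  have h2 := ((((hc.pow 2).sub_const 1).const_mul M).add_const 1).mul (hz.pow 2)
  have h3 := (((((h1.add h2).sub ((hx.const_mul 2).mul hp)).add
    ((hp.pow 2).const_mul M)).const_mul (1 / 2)).sub (hc.const_mul g))
  refine HasDerivWithinAt.congr_deriv h3 ?_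
  simp
  ring

variable {M g μ : ℝ} {X : RedVec → RedVec}

theorem IsSolutionOn.components (hX : ∀ z ∈ redSpace, X z = polyField M g μ z) {γ : ℝ → RedVec}
    {s : Set ℝ} (hγ : IsSolutionOn X redSpace γ s) {t : ℝ} (ht : t ∈ s) :
    HasDerivWithinAt (fun t => (γ t).1 0)
      (1 / μ * fieldX M ((γ t).1 1) ((γ t).1 2) (coth (γ t).2.1)) s t ∧
    HasDerivWithinAt (fun t => (γ t).1 1)
      (1 / μ * fieldY M ((γ t).1 0) ((γ t).1 1) ((γ t).1 2) (coth (γ t).2.1) (γ t).2.2) s t ∧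
    HasDerivWithinAt (fun t => (γ t).1 2)
      (1 / μ * fieldZ ((γ t).1 0) ((γ t).1 1) ((γ t).1 2) (coth (γ t).2.1) (γ t).2.2) s t ∧
    HasDerivWithinAt (fun t => coth (γ t).2.1)
      (1 / μ * ((1 - coth (γ t).2.1 ^ 2) * (M * (γ t).2.2 - (γ t).1 0))) s t ∧
    HasDerivWithinAt (fun t => (γ t).2.2)
      (1 / μ * fieldP M g ((γ t).1 1) ((γ t).1 2) (coth (γ t).2.1)) s t := by
  obtain ⟨hz, hd⟩ := hγ t ht
  rw [hX _ hz] at hd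
  have h1 : HasDerivWithinAt (fun t => (γ t).1) (polyField M g μ (γ t)).1 s t := by
    have := (hasFDerivAt_fst (𝕜 := ℝ) (p := γ t)).comp_hasDerivWithinAt t hd
    exact this
  have h2 : HasDerivWithinAt (fun t => (γ t).2) (polyField M g μ (γ t)).2 s t := by
    have := (hasFDerivAt_snd (𝕜 := ℝ) (p := γ t)).comp_hasDerivWithinAt t hd
    exact this
  have hq : HasDerivWithinAt (fun t => (γ t).2.1) (polyField M g μ (γ t)).2.1 s t := by
    have := (hasFDerivAt_fst (𝕜 := ℝ) (p := (γ t).2)).comp_hasDerivWithinAt t h2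
    exact this
  have hp : HasDerivWithinAt (fun t => (γ t).2.2) (polyField M g μ (γ t)).2.2 s t := by
    have := (hasFDerivAt_snd (𝕜 := ℝ) (p := (γ t).2)).comp_hasDerivWithinAt t h2
    exact this
  have hm := hasDerivWithinAt_pi.1 h1
  refine ⟨hm 0, hm 1, hm 2, ?_, hp⟩
  refine ((hasDerivAt_coth hz).comp_hasDerivWithinAt t hq).congr_deriv ?_
  simp only [polyField]
  ring

theorem eq_of_hasDerivWithinAt_zero {f : ℝ → ℝ} {T : ℝ} (hT : 0 ≤ T)
    (hf : ∀ t ∈ Icc 0 T, HasDerivWithinAt f 0 (Icc 0 T) t) : f T = f 0 := by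
  refine constant_of_has_deriv_right_zero (fun t ht => (hf t ht).continuousWithinAt)
    (fun t ht => ?_) T (right_mem_Icc.2 hT)
  exact (hf t (Ico_subset_Icc_self ht)).mono_of_mem_nhdsWithin
    (mem_of_superset (Icc_mem_nhdsGE ht.2) (Icc_subset_Icc_left ht.1))

theorem IsSolutionOn.energy_eq (hX : ∀ z ∈ redSpace, X z = polyField M g μ z) {γ : ℝ → RedVec}
    {T : ℝ} (hT : 0 ≤ T) (hγ : IsSolutionOn X redSpace γ (Icc 0 T)) :
    stateEnergy M g (γ T) = stateEnergy M g (γ 0) := by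
  refine eq_of_hasDerivWithinAt_zero (f := fun t => stateEnergy M g (γ t)) hT fun t ht => ?_
  obtain ⟨hx, hy, hz, hc, hp⟩ := hγ.components hX ht
  refine (hasDerivWithinAt_energy M g hx hy hz hc hp).congr_deriv ?_
  unfold fieldX fieldY fieldZ fieldP
  ring

theorem IsSolutionOn.casimir_eq (hX : ∀ z ∈ redSpace, X z = polyField M g μ z) {γ : ℝ → RedVec}
    {T : ℝ} (hT : 0 ≤ T) (hγ : IsSolutionOn X redSpace γ (Icc 0 T)) :
    casimir (γ T) = casimir (γ 0) := by
  refine eq_of_hasDerivWithinAt_zero (f := fun t => casimir (γ t)) hT fun t ht => ?_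
  obtain ⟨hx, hy, hz, -, -⟩ := hγ.components hX ht
  rw [funext fun t => LobachevskyTwoBody.casimir_eq (γ t)]
  refine (((hz.pow 2).sub (hy.pow 2)).sub (hx.pow 2)).congr_deriv ?_
  unfold fieldX fieldY fieldZ
  simp
  ring

theorem devOf_cas (r Z c : ℝ) (z : RedVec) :
    (devOf r Z c z).cas r Z = casimir z - (Z ^ 2 - (r * Z) ^ 2) := by
  rw [Dev.cas_eq, LobachevskyTwoBody.casimir_eq, devOf]
  ring

theorem devOf_aug (M g r Z c : ℝ) (z : RedVec) :
    (devOf r Z c z).aug M g r Z c = stateEnergy M g z - 1 / 2 * (c / r - 1) * casimir z -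
      (energy M g 0 (r * Z) Z c 0 + 1 / 2 * (c / r - 1) * ((r * Z) ^ 2 - Z ^ 2)) := by
  rw [Dev.aug, LobachevskyTwoBody.casimir_eq, devOf, stateEnergy]
  simp only [add_sub_cancel]
  ring

/-- The reduced state `((0, r Z, Z), q, 0)`. -/
def equilibriumState (r Z q : ℝ) : RedVec := (![0, r * Z, Z], q, 0)

theorem devOf_equilibriumState (r Z q : ℝ) : devOf r Z (coth q) (equilibriumState r Z q) = 0 := by
  simp [devOf, equilibriumState]

theorem tendsto_devOf (r Z : ℝ) {q : ℝ} (hq : 0 < q) :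
    Tendsto (devOf r Z (coth q)) (𝓝 (equilibriumState r Z q)) (𝓝 0) := by
  have := continuousAt_devOf r Z (coth q) (z := equilibriumState r Z q) hq
  rwa [ContinuousAt, devOf_equilibriumState] at this

theorem eq_of_devOf_sq {r Z q : ℝ} (hq : 0 < q) {z : RedVec} (hz : z ∈ redSpace)
    (h : (devOf r Z (coth q) z).sq = 0) : z = equilibriumState r Z q := by
  unfold Dev.sq devOf at h
  simp only at h
  have n0 := sq_nonneg (z.1 0)
  have n1 := sq_nonneg (z.1 1 - r * Z)
  have n2 := sq_nonneg (z.1 2 - Z)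
  have n3 := sq_nonneg (coth z.2.1 - coth q)
  have n4 := sq_nonneg z.2.2
  have h0 : z.1 0 = 0 := pow_eq_zero_iff two_ne_zero |>.1 (by linarith)
  have h1 : z.1 1 - r * Z = 0 := pow_eq_zero_iff two_ne_zero |>.1 (by linarith)
  have h2 : z.1 2 - Z = 0 := pow_eq_zero_iff two_ne_zero |>.1 (by linarith)
  have h3 : coth z.2.1 - coth q = 0 := pow_eq_zero_iff two_ne_zero |>.1 (by linarith)
  have h4 : z.2.2 = 0 := pow_eq_zero_iff two_ne_zero |>.1 (by linarith)
  refine Prod.ext ?_ (Prod.ext ?_ h4)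
  · ext i
    fin_cases i
    · exact h0
    · exact sub_eq_zero.1 h1
    · exact sub_eq_zero.1 h2
  · exact coth_injOn hz hq (sub_eq_zero.1 h3)

namespace IsEquilibriumData

variable {r Z q : ℝ}

theorem polyField_eq_zero (h : IsEquilibriumData M g r Z (coth q)) :
    polyField M g μ (equilibriumState r Z q) = 0 := by
  have h1 : fieldX M (r * Z) Z (coth q) = 0 := by
    unfold fieldX
    linear_combination (-Z ^ 2) * h.ratio
  have h2 : fieldP M g (r * Z) Z (coth q) = 0 := by
    unfold fieldP
    linear_combination (coth q ^ 2 - 1) * h.balance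
  simp only [polyField, equilibriumState, Matrix.cons_val]
  rw [h1, h2]
  refine Prod.ext ?_ (Prod.ext ?_ ?_)
  · ext i
    fin_cases i <;> simp [fieldY, fieldZ]
  · simp
  · simp

/-- `S` is already positive definite, so coercivity holds with `κ = 0`. The term `K cas²` makes the
integral have a strict minimum in the full space, hence perturbations that change the Casimir value
are covered too. -/
theorem isLyapunovStable (h : IsEquilibriumData M g r Z (coth q)) (hq : 0 < q) (hr : r ^ 2 ≠ 1)
    (hX : ∀ z ∈ redSpace, X z = polyField M g μ z) (hXd : ∀ z ∈ redSpace, ContDiffAt ℝ 1 X z)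
    (hS : S₁₂ M r Z (coth q) ^ 2 < S₁₁ r Z (coth q) * S₂₂ M Z (coth q)) :
    IsLyapunovStable X redSpace (equilibriumState r Z q) := by
  have hmem : equilibriumState r Z q ∈ redSpace := hq
  obtain ⟨m, K, hm, hco⟩ := h.coercive hr (κ := 0) (a₁ := 0) (a₂ := 0)
    (by have := h.S₁₁_pos hr; linarith) (by nlinarith)
  set F : RedVec → ℝ := fun z => (devOf r Z (coth q) z).aug M g r Z (coth q) +
    K * (devOf r Z (coth q) z).cas r Z ^ 2 with hF
  have hF0 : F (equilibriumState r Z q) = 0 := by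
    simp only [hF, devOf_equilibriumState]
    simp [Dev.aug, Dev.cas, Dev.l]
  refine isLyapunovStable_of_integral isOpen_redSpace hXd hmem
    (by rw [hX _ hmem, h.polyField_eq_zero]) (F := F) ?_ ?_ ?_
  · intro z hz
    have hd := continuousAt_devOf r Z (coth q) hz
    have h1 : Continuous fun d : Dev => d.aug M g r Z (coth q) + K * d.cas r Z ^ 2 := by
      unfold Dev.aug Dev.cas Dev.l energy
      fun_prop
    exact (h1.continuousAt.comp hd).continuousWithinAt
  · filter_upwards [(tendsto_devOf r Z hq).eventually hco,
      isOpen_redSpace.mem_nhds hmem] with z hz hzm hne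
    rw [hF0]
    have hs : 0 ≤ (devOf r Z (coth q) z).sq := by unfold Dev.sq; positivity
    have hs' : 0 < (devOf r Z (coth q) z).sq :=
      hs.lt_of_ne fun he => hne (eq_of_devOf_sq hq hzm he.symm)
    have := mul_pos hm hs'
    simp only [hF]
    linarith
  · intro γ T hT hγ
    simp only [hF, devOf_aug, devOf_cas, hγ.energy_eq hX hT, hγ.casimir_eq hX hT]

end IsEquilibriumData

end Flow

/-! ### The eigenvector of the linearization -/

section Instability

open Filter Topology Set

variable {M g μ : ℝ} {X : RedVec → RedVec} {r Z q : ℝ}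

theorem hasDerivAt_fieldX (M : ℝ) {y z c : ℝ → ℝ} {y' z' c' t : ℝ} (hy : HasDerivAt y y' t)
    (hz : HasDerivAt z z' t) (hc : HasDerivAt c c' t) :
    HasDerivAt (fun t => fieldX M (y t) (z t) (c t))
      (-(c' * (y t ^ 2 + z t ^ 2)) - 2 * c t * (y t * y' + z t * z') +
        2 * M * c t * c' * (y t * z t) + (M * (c t ^ 2 - 1) + 2) * (y' * z t + y t * z')) t := by
  have h := (((hc.neg.mul (hy.pow 2)).add (((((hc.pow 2).sub_const 1).const_mul M).add_const
    2).mul hy |>.mul hz)).sub (hc.mul (hz.pow 2)))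
  refine HasDerivAt.congr_deriv h ?_
  simp
  ring

theorem hasDerivAt_fieldY (M : ℝ) {x y z c p : ℝ → ℝ} {x' y' z' c' p' t : ℝ}
    (hx : HasDerivAt x x' t) (hy : HasDerivAt y y' t)
    (hz : HasDerivAt z z' t) (hc : HasDerivAt c c' t) (hp : HasDerivAt p p' t)
    (hx0 : x t = 0) (hp0 : p t = 0) :
    HasDerivAt (fun t => fieldY M (x t) (y t) (z t) (c t) (p t))
      (z t * p' - (M * (c t ^ 2 - 1) + 2) * x' * z t + c t * x' * y t) t := by
  have h := (((hz.mul hp).sub (((((hc.pow 2).sub_const 1).const_mul M).add_const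
    2).mul hx |>.mul hz)).add ((hc.mul hx).mul hy))
  refine HasDerivAt.congr_deriv h ?_
  simp [hx0, hp0]

theorem hasDerivAt_fieldZ {x y z c p : ℝ → ℝ} {x' y' z' c' p' t : ℝ}
    (hx : HasDerivAt x x' t) (hy : HasDerivAt y y' t)
    (hz : HasDerivAt z z' t) (hc : HasDerivAt c c' t) (hp : HasDerivAt p p' t)
    (hx0 : x t = 0) (hp0 : p t = 0) :
    HasDerivAt (fun t => fieldZ (x t) (y t) (z t) (c t) (p t)) (y t * p' - c t * x' * z t) t := by
  have h := (hy.mul hp).sub ((hc.mul hx).mul hz)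
  refine HasDerivAt.congr_deriv h ?_
  simp [hx0, hp0]

theorem hasDerivAt_fieldP (M g : ℝ) {y z c : ℝ → ℝ} {y' z' c' t : ℝ} (hy : HasDerivAt y y' t)
    (hz : HasDerivAt z z' t) (hc : HasDerivAt c c' t)
    (h0 : M * c t * z t ^ 2 - y t * z t - g = 0) :
    HasDerivAt (fun t => fieldP M g (y t) (z t) (c t))
      ((c t ^ 2 - 1) * (M * c' * z t ^ 2 + 2 * M * c t * z t * z' - y' * z t - y t * z')) t := by
  have h := ((hc.pow 2).sub_const 1).mul ((((hc.const_mul M).mul (hz.pow 2)).sub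
    (hy.mul hz)).sub_const g)
  refine HasDerivAt.congr_deriv h ?_
  simp [h0, -mul_eq_mul_left_iff]
  ring

/-- A real eigenvector `v` stays one after complexification, as `1 ⊗ v ≠ 0`. -/
theorem isLinearlyUnstable_of_eigenvector {E : Type*} [NormedAddCommGroup E] [NormedSpace ℝ E]
    {X : E → E} {D : Set E} {z₀ v : E} {l : ℝ} (hz : z₀ ∈ D) (h0 : X z₀ = 0) (hl : 0 < l)
    (hv : v ≠ 0) (h : fderiv ℝ X z₀ v = l • v) : IsLinearlyUnstable X D z₀ := by
  refine ⟨hz, h0, l, by simpa using hl, ?_⟩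
  refine Module.End.hasEigenvalue_of_hasEigenvector (x := (1 : ℂ) ⊗ₜ[ℝ] v) ⟨?_, ?_⟩
  · rw [Module.End.mem_eigenspace_iff, LinearMap.baseChange_tmul, TensorProduct.smul_tmul']
    change (1 : ℂ) ⊗ₜ[ℝ] (fderiv ℝ X z₀ v) = _
    rw [h, ← TensorProduct.smul_tmul]
    simp
  · intro hzero
    exact hv ((Module.FaithfullyFlat.one_tmul_eq_zero_iff ℝ E v (A := ℂ)).1 hzero)

namespace IsEquilibriumData

/-- This vector has `(x, p) = a`, `(u, e) = b` and `l = 0`, so it is tangent to the Casimir level;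
the relations `S b = l a` and `-T a = l b` are the eigenvalue equation. The sign of `-b₂` comes from
`dc = -(c² - 1) dq`. -/
theorem fderiv_eigenvector (h : IsEquilibriumData M g r Z (coth q)) (hq : 0 < q)
    (hX : ∀ z ∈ redSpace, X z = polyField M g μ z) (hXd : ∀ z ∈ redSpace, ContDiffAt ℝ 1 X z)
    {l a₁ a₂ b₁ b₂ : ℝ}
    (e₁ : coth q / r * a₁ - a₂ = -(l * b₁)) (e₂ : -a₁ + M * a₂ = -(l * b₂))
    (e₃ : S₁₁ r Z (coth q) * b₁ + S₁₂ M r Z (coth q) * b₂ = l * a₁)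
    (e₄ : S₁₂ M r Z (coth q) * b₁ + S₂₂ M Z (coth q) * b₂ = l * a₂) :
    fderiv ℝ X (equilibriumState r Z q) (![a₁, Z * b₁, r * Z * b₁], -b₂, a₂) =
      (1 / μ * l) • ((![a₁, Z * b₁, r * Z * b₁], -b₂, a₂) : RedVec) := by
  have hmem : equilibriumState r Z q ∈ redSpace := hq
  have hr0 := h.r_pos.ne'
  set z₀ := equilibriumState r Z q with hz₀
  set v : RedVec := (![a₁, Z * b₁, r * Z * b₁], -b₂, a₂) with hv
  have hline : HasDerivAt (fun s : ℝ => z₀ + s • v) v 0 := by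
    simpa using ((hasDerivAt_id (0 : ℝ)).smul_const v).const_add z₀
  have hXz : HasFDerivAt X (fderiv ℝ X z₀) (z₀ + (0 : ℝ) • v) := by
    rw [zero_smul, add_zero]
    exact ((hXd _ hmem).differentiableAt one_ne_zero).hasFDerivAt
  have h1 := hXz.comp_hasDerivAt (0 : ℝ) hline
  refine h1.unique ?_
  have hq' : HasDerivAt (fun s : ℝ => q + s * -b₂) (-b₂) 0 := by
    simpa using ((hasDerivAt_id (0 : ℝ)).mul_const (-b₂)).const_add q
  have hev : (X ∘ fun s : ℝ => z₀ + s • v) =ᶠ[𝓝 0] fun s => polyField M g μ (z₀ + s • v) := by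
    have : ∀ᶠ s : ℝ in 𝓝 0, 0 < q + s * -b₂ :=
      hq'.continuousAt.eventually (lt_mem_nhds (by simpa using hq))
    filter_upwards [this] with s hs using hX _ (by simpa [redSpace, z₀, v, equilibriumState] using hs)
  refine HasDerivAt.congr_of_eventuallyEq ?_ hev
  have hx : HasDerivAt (fun s : ℝ => s * a₁) a₁ 0 := by
    simpa using (hasDerivAt_id (0 : ℝ)).mul_const a₁
  have hp : HasDerivAt (fun s : ℝ => s * a₂) a₂ 0 := by
    simpa using (hasDerivAt_id (0 : ℝ)).mul_const a₂
  have hy : HasDerivAt (fun s : ℝ => r * Z + s * (Z * b₁)) (Z * b₁) 0 := by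
    simpa using ((hasDerivAt_id (0 : ℝ)).mul_const (Z * b₁)).const_add (r * Z)
  have hz : HasDerivAt (fun s : ℝ => Z + s * (r * Z * b₁)) (r * Z * b₁) 0 := by
    simpa using ((hasDerivAt_id (0 : ℝ)).mul_const (r * Z * b₁)).const_add Z
  have hc : HasDerivAt (fun s : ℝ => coth (q + s * -b₂)) ((coth q ^ 2 - 1) * b₂) 0 := by
    have h2 : HasDerivAt coth (1 - coth q ^ 2) (q + 0 * -b₂) := by
      rw [zero_mul, add_zero]; exact hasDerivAt_coth hq
    have h3 := HasDerivAt.comp (0 : ℝ) h2 hq'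
    exact HasDerivAt.congr_deriv h3 (by ring)
  have hEe : M * (coth q ^ 2 - 1) + 2 = coth q / r * (r ^ 2 + 1) := by
    rw [div_mul_eq_mul_div, eq_div_iff hr0, ← h.ratio]
  have hkr : coth q / r * r = coth q := div_mul_cancel₀ _ hr0
  have hbal := h.balance
  have dX := hasDerivAt_fieldX M hy hz hc
  have dY := hasDerivAt_fieldY M hx hy hz hc hp (by simp) (by simp)
  have dZ := hasDerivAt_fieldZ hx hy hz hc hp (by simp) (by simp)
  have dP := hasDerivAt_fieldP M g hy hz hc (by simp; linear_combination hbal)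
  simp only [zero_mul, add_zero] at dX dY dZ dP
  have hform : ∀ s : ℝ, polyField M g μ (z₀ + s • v) =
      (![1 / μ * fieldX M (r * Z + s * (Z * b₁)) (Z + s * (r * Z * b₁)) (coth (q + s * -b₂)),
        1 / μ * fieldY M (s * a₁) (r * Z + s * (Z * b₁)) (Z + s * (r * Z * b₁))
          (coth (q + s * -b₂)) (s * a₂),
        1 / μ * fieldZ (s * a₁) (r * Z + s * (Z * b₁)) (Z + s * (r * Z * b₁))
          (coth (q + s * -b₂)) (s * a₂)],
       1 / μ * (M * (s * a₂) - s * a₁),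
       1 / μ * fieldP M g (r * Z + s * (Z * b₁)) (Z + s * (r * Z * b₁)) (coth (q + s * -b₂))) := by
    intro s
    simp [polyField, z₀, v, equilibriumState]
  rw [funext hform]
  unfold S₁₁ S₁₂ S₂₂ at *
  generalize coth q = c at *
  generalize c / r = k at *
  refine HasDerivAt.prodMk (hasDerivAt_pi.2 fun i => ?_) (HasDerivAt.prodMk ?_ ?_)
  · fin_cases i
    · refine (dX.const_mul (1 / μ)).congr_deriv ?_
      simp [v, -mul_eq_mul_left_iff]
      linear_combination μ⁻¹ * e₃ + μ⁻¹ * (Z ^ 2 * b₁ * (1 + r ^ 2)) * hEe +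
        μ⁻¹ * (4 * Z ^ 2 * b₁ * r) * hkr
    · refine (dY.const_mul (1 / μ)).congr_deriv ?_
      simp [v, -mul_eq_mul_left_iff]
      linear_combination μ⁻¹ * (-Z) * e₁ - μ⁻¹ * a₁ * Z * hEe - μ⁻¹ * a₁ * Z * r * hkr
    · refine (dZ.const_mul (1 / μ)).congr_deriv ?_
      simp [v, -mul_eq_mul_left_iff]
      linear_combination μ⁻¹ * (-Z * r) * e₁ + μ⁻¹ * a₁ * Z * hkr
  · refine (((hp.const_mul M).sub hx).const_mul (1 / μ)).congr_deriv ?_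
    simp [v, -mul_eq_mul_left_iff]
    linear_combination (μ⁻¹) * e₂
  · refine (dP.const_mul (1 / μ)).congr_deriv ?_
    simp [v, -mul_eq_mul_left_iff]
    linear_combination μ⁻¹ * e₄

end IsEquilibriumData

end Instability

/-! ### Instability within the Casimir level -/

section Chetaev

open Filter Topology Set

variable {M g μ : ℝ} {X : RedVec → RedVec} {r Z q : ℝ}

namespace IsEquilibriumData

/-- Near the equilibrium, on the level set of the Casimir function, there are states of nonpositive
relative energy with `φ ψ > 0`. -/
theorem frequently_near (h : IsEquilibriumData M g r Z (coth q)) (hq : 0 < q) (hr : r ^ 2 ≠ 1)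
    {l a₁ a₂ b₁ b₂ : ℝ} (hl : 0 < l)
    (e₃ : S₁₁ r Z (coth q) * b₁ + S₁₂ M r Z (coth q) * b₂ = l * a₁)
    (e₄ : S₁₂ M r Z (coth q) * b₁ + S₂₂ M Z (coth q) * b₂ = l * a₂)
    (hb₂ : 0 < b₂) (hab : a₁ * b₁ + a₂ * b₂ < 0) :
    ∃ᶠ z in 𝓝 (equilibriumState r Z q), (devOf r Z (coth q) z).cas r Z = 0 ∧
      (devOf r Z (coth q) z).aug M g r Z (coth q) ≤ 0 ∧
      0 < (a₁ * (devOf r Z (coth q) z).u r Z + a₂ * (devOf r Z (coth q) z).e (coth q)) *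
        (b₁ * (devOf r Z (coth q) z).1 + b₂ * (devOf r Z (coth q) z).2.2.2.2) := by
  have hZ := h.Z_ne
  have hN : 1 - r ^ 2 ≠ 0 := sub_ne_zero.2 hr.symm
  have hD := h.D_pos
  have hM : 0 < M := one_pos.trans h.one_lt_M
  set c := coth q with hc
  -- the size of the momentum
  set P := √(-(l * (a₁ * b₁ + a₂ * b₂)) / (2 * M)) with hP
  have hlab : 0 < -(l * (a₁ * b₁ + a₂ * b₂)) := by nlinarith
  have hP0 : 0 < P := Real.sqrt_pos.2 (by positivity)
  have hP2 : M * P ^ 2 = -(l * (a₁ * b₁ + a₂ * b₂)) / 2 := by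
    rw [hP, Real.sq_sqrt (by positivity)]; field_simp
  -- The correction that keeps the curve exactly on the Casimir level: `1 + s² k` must equal `√(1 +
  -- s² b₁²)`, written without cancellation so that `k` is continuous at `0`.
  set k : ℝ → ℝ := fun s => b₁ ^ 2 / (√(1 + s ^ 2 * b₁ ^ 2) + 1) with hk
  have hkc : Continuous k := by
    have : ∀ s : ℝ, √(1 + s ^ 2 * b₁ ^ 2) + 1 ≠ 0 := fun s => by positivity
    exact continuous_const.div (by fun_prop) this
  have hkeq : ∀ s : ℝ, (s ^ 2 * k s) ^ 2 + 2 * (s ^ 2 * k s) = s ^ 2 * b₁ ^ 2 := fun s => by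
    have h1 : √(1 + s ^ 2 * b₁ ^ 2) ^ 2 = 1 + s ^ 2 * b₁ ^ 2 := Real.sq_sqrt (by positivity)
    have h2 : √(1 + s ^ 2 * b₁ ^ 2) + 1 ≠ 0 := by positivity
    have h3 : s ^ 2 * k s = √(1 + s ^ 2 * b₁ ^ 2) - 1 := by
      rw [hk, ← mul_div_assoc, div_eq_iff h2]
      linear_combination -h1
    rw [h3]
    linear_combination h1
  set C : ℝ → ℝ := fun s => (coth (q - s * b₂) - c) / s with hC
  have hqd : HasDerivAt (fun s : ℝ => q - s * b₂) (-b₂) 0 := by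
    simpa using ((hasDerivAt_id (0 : ℝ)).mul_const b₂).const_sub q
  have hCt : Tendsto C (𝓝[≠] 0) (𝓝 ((c ^ 2 - 1) * b₂)) := by
    have h2 : HasDerivAt coth (1 - c ^ 2) (q - 0 * b₂) := by
      rw [zero_mul, sub_zero]; exact hasDerivAt_coth hq
    have h3 := (HasDerivAt.comp (0 : ℝ) h2 hqd).tendsto_slope
    have h4 : (1 - c ^ 2) * -b₂ = (c ^ 2 - 1) * b₂ := by ring
    rw [h4] at h3
    refine h3.congr fun s => ?_
    simp [slope_def_field, hC, hc]
  set ζ : ℝ → RedVec := fun s =>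
    (![0, r * Z + s * (r * Z * k s * s + Z * b₁), Z + s * (Z * k s * s + r * Z * b₁)],
      q - s * b₂, -P * s) with hζ
  have hζt : Tendsto ζ (𝓝[≠] 0) (𝓝 (equilibriumState r Z q)) := by
    have : Continuous ζ := by
      refine Continuous.prodMk (continuous_pi fun i => ?_) (by fun_prop)
      fin_cases i
      · exact continuous_const
      · change Continuous fun s => r * Z + s * (r * Z * k s * s + Z * b₁)
        fun_prop
      · change Continuous fun s => Z + s * (Z * k s * s + r * Z * b₁)
        fun_prop
    have h0 : ζ 0 = equilibriumState r Z q := by simp [hζ, equilibriumState]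
    rw [← h0]
    exact this.continuousAt.tendsto.mono_left nhdsWithin_le_nhds
  have hdev : ∀ s : ℝ, s ≠ 0 → devOf r Z c (ζ s) =
      (0, s * (r * Z * k s * s + Z * b₁), s * (Z * k s * s + r * Z * b₁), s * C s, -P * s) := by
    intro s hs
    have : s * C s = coth (q - s * b₂) - c := by
      simp only [hC]; field_simp
    rw [this]
    simp [devOf, hζ]
  -- `J` is the relative energy divided by `s²`, as a continuous function of `s`, `k s` and the
  -- difference quotient `C s`; its limit is `l (a·b) / 4 < 0`.
  set J : ℝ × ℝ × ℝ → ℝ := fun y => M / 2 * P ^ 2 + 1 / 2 * (S₁₁ r Z c * b₁ ^ 2 +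
    2 * S₁₂ M r Z c * b₁ * (y.2.2 / (c ^ 2 - 1)) + S₂₂ M Z c * (y.2.2 / (c ^ 2 - 1)) ^ 2) +
    coupling M r Z c * (y.2.2 / (c ^ 2 - 1)) * (y.1 * y.2.1 * (Z * (1 - r ^ 2))) +
    y.1 * (-(y.2.2 * (r * Z * y.2.1 * y.1 + Z * b₁) * (Z * y.2.1 * y.1 + r * Z * b₁)) +
      M * c * (y.2.2 * (Z * y.2.1 * y.1 + r * Z * b₁) ^ 2) +
      M * Z * (y.2.2 ^ 2 * (Z * y.2.1 * y.1 + r * Z * b₁)) +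
      M / 2 * y.1 * (y.2.2 ^ 2 * (Z * y.2.1 * y.1 + r * Z * b₁) ^ 2)) with hJ
  have htrip : Tendsto (fun s => (s, k s, C s)) (𝓝[≠] 0) (𝓝 (0, k 0, (c ^ 2 - 1) * b₂)) :=
    (tendsto_id.mono_left nhdsWithin_le_nhds).prodMk_nhds
      ((hkc.continuousAt.tendsto.mono_left nhdsWithin_le_nhds).prodMk_nhds hCt)
  have hJt : Tendsto (fun s => J (s, k s, C s)) (𝓝[≠] 0) (𝓝 (J (0, k 0, (c ^ 2 - 1) * b₂))) := by
    have hJc : Continuous J := by rw [hJ]; fun_prop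
    exact hJc.continuousAt.tendsto.comp htrip
  have hJ0 : J (0, k 0, (c ^ 2 - 1) * b₂) < 0 := by
    simp only [hJ]
    rw [mul_div_cancel_left₀ _ hD.ne']
    have : ∀ x : ℝ, x = l * (a₁ * b₁ + a₂ * b₂) / 4 → x < 0 := fun x hx => by
      rw [hx]
      linarith
    apply this
    linear_combination 1 / 2 * hP2 + b₁ / 2 * e₃ + b₂ / 2 * e₄
  have hφt : Tendsto (fun s => a₁ * b₁ + a₂ * (C s / (c ^ 2 - 1))) (𝓝[≠] 0)
      (𝓝 (a₁ * b₁ + a₂ * b₂)) := by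
    have := ((hCt.div_const (c ^ 2 - 1)).const_mul a₂).const_add (a₁ * b₁)
    rwa [mul_div_cancel_left₀ _ hD.ne'] at this
  have hev : ∀ᶠ s in 𝓝[≠] (0 : ℝ), (devOf r Z c (ζ s)).cas r Z = 0 ∧
      (devOf r Z c (ζ s)).aug M g r Z c ≤ 0 ∧
      0 < (a₁ * (devOf r Z c (ζ s)).u r Z + a₂ * (devOf r Z c (ζ s)).e c) *
        (b₁ * (devOf r Z c (ζ s)).1 + b₂ * (devOf r Z c (ζ s)).2.2.2.2) := by
    filter_upwards [hJt.eventually (gt_mem_nhds hJ0), hφt.eventually (gt_mem_nhds hab),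
      self_mem_nhdsWithin] with s hs1 hs2 hs
    have hs : s ≠ 0 := hs
    rw [hdev s hs]
    have hu : Dev.u r Z (0, s * (r * Z * k s * s + Z * b₁), s * (Z * k s * s + r * Z * b₁),
        s * C s, -P * s) = s * b₁ := by
      unfold Dev.u
      field_simp
      ring
    have he : Dev.e c (0, s * (r * Z * k s * s + Z * b₁), s * (Z * k s * s + r * Z * b₁),
        s * C s, -P * s) = s * (C s / (c ^ 2 - 1)) := by
      unfold Dev.e
      ring
    refine ⟨?_, ?_, ?_⟩
    · rw [Dev.cas_eq]
      linear_combination (Z ^ 2 * (1 - r ^ 2)) * hkeq s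
    · rw [h.aug_eq hr, hu, he]
      have : ∀ x : ℝ, x = s ^ 2 * J (s, k s, C s) → x ≤ 0 := fun x hx => by
        rw [hx]
        exact mul_nonpos_of_nonneg_of_nonpos (sq_nonneg s) hs1.le
      apply this
      simp only [hJ, Dev.l]
      ring
    · rw [hu, he]
      have h1 : (a₁ * (s * b₁) + a₂ * (s * (C s / (c ^ 2 - 1)))) * (b₁ * 0 + b₂ * (-P * s)) =
          s ^ 2 * (-(a₁ * b₁ + a₂ * (C s / (c ^ 2 - 1))) * (b₂ * P)) := by ring
      rw [h1]
      have h2 : 0 < -(a₁ * b₁ + a₂ * (C s / (c ^ 2 - 1))) := by linarith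
      positivity
  exact hζt.frequently hev.frequently

/-- The equilibrium is unstable if the second variation of the energy is indefinite on the level
set of the Casimir function. -/
theorem isUnstable (h : IsEquilibriumData M g r Z (coth q)) (hq : 0 < q) (hr : r ^ 2 ≠ 1)
    (hμ : 0 < μ)
    (hX : ∀ z ∈ redSpace, X z = polyField M g μ z) (hXd : ∀ z ∈ redSpace, ContDiffAt ℝ 1 X z)
    (hS : S₁₁ r Z (coth q) * S₂₂ M Z (coth q) < S₁₂ M r Z (coth q) ^ 2) :
    IsLinearlyUnstable X redSpace (equilibriumState r Z q) ∧
      IsLyapunovUnstableWithin X redSpace {w | casimir w = casimir (equilibriumState r Z q)}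
        (equilibriumState r Z q) := by
  have hmem : equilibriumState r Z q ∈ redSpace := hq
  have h0 : X (equilibriumState r Z q) = 0 := by rw [hX _ hmem, h.polyField_eq_zero]
  obtain ⟨l, a₁, a₂, b₁, b₂, hl, e₁, e₂, e₃, e₄, hb₂, hab⟩ :=
    exists_hyperbolic_mode h.k_pos h.one_lt_kM (h.S₁₁_pos hr) hS
  refine ⟨isLinearlyUnstable_of_eigenvector hmem h0 (v := (![a₁, Z * b₁, r * Z * b₁], -b₂, a₂))
    (l := 1 / μ * l) (by positivity) ?_ (h.fderiv_eigenvector hq hX hXd e₁ e₂ e₃ e₄), ?_⟩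
  · intro hv
    have : -b₂ = 0 := congrArg (fun w : RedVec => w.2.1) hv
    linarith
  obtain ⟨κ, hκ, hα, hαγ⟩ := exists_posDef_add_sq hl (h.S₁₁_pos hr) hS e₃ e₄ hab
  obtain ⟨m, K, hm, hco⟩ := h.coercive hr hα hαγ
  have hgrow := h.growth hr hl e₁ e₂ e₃ e₄ hκ hm hco
  set c := coth q with hc
  set dev := devOf r Z c with hdev
  have hcas0 : casimir (equilibriumState r Z q) = Z ^ 2 - (r * Z) ^ 2 := by
    simp [LobachevskyTwoBody.casimir_eq, equilibriumState]
  -- The set `A` is invariant because energy and Casimir function are integrals; `V = φ ψ` is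
  -- Chetaev's function and `W` its derivative along the flow.
  refine isLyapunovUnstableWithin_of_chetaev isOpen_redSpace hXd hmem h0
    (A := {z | (dev z).cas r Z = 0 ∧ (dev z).aug M g r Z c ≤ 0})
    (V := fun z => (a₁ * (dev z).u r Z + a₂ * (dev z).e c) *
      (b₁ * (dev z).1 + b₂ * (dev z).2.2.2.2))
    (W := fun z => 1 / μ * ((dev z).evenRate M r Z c a₁ a₂ *
      (b₁ * (dev z).1 + b₂ * (dev z).2.2.2.2) +
      (a₁ * (dev z).u r Z + a₂ * (dev z).e c) * (dev z).oddRate M g r Z c b₁ b₂))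
    (c := 1 / μ * (l / 2)) ?_ ?_ ?_ ?_ (by positivity) ?_ ?_
  · rintro z ⟨hz, -⟩
    have hz' := devOf_cas r Z c z
    change casimir z = _
    rw [hcas0]
    linarith
  · rintro γ T hT hγ ⟨h1, h2⟩
    simp only [mem_ofPred_eq, hdev, devOf_aug, devOf_cas, hγ.energy_eq hX hT,
      hγ.casimir_eq hX hT] at h1 h2 ⊢
    exact ⟨h1, h2⟩
  · intro z hz
    have hd := continuousAt_devOf r Z c hz
    have h1 : Continuous fun d : Dev => (a₁ * d.u r Z + a₂ * d.e c) *
        (b₁ * d.1 + b₂ * d.2.2.2.2) := by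
      unfold Dev.u Dev.e
      fun_prop
    exact (h1.continuousAt.comp hd).continuousWithinAt
  · intro γ s hγ t ht
    obtain ⟨hx, hy, hz, hcd, hp⟩ := hγ.components hX ht
    have hφ := (((hy.sub_const (r * Z)).sub ((hz.sub_const Z).const_mul r)).div_const
      (Z * (1 - r ^ 2)) |>.const_mul a₁).add (((hcd.sub_const c).div_const
      (c ^ 2 - 1)).const_mul a₂)
    have hψ := (hx.const_mul b₁).add (hp.const_mul b₂)
    refine HasDerivWithinAt.congr_deriv (hφ.mul hψ) ?_
    simp only [hdev, devOf, Dev.evenRate, Dev.oddRate, Dev.u, Dev.e, add_sub_cancel, Pi.add_apply,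
      Pi.sub_apply]
    ring
  · filter_upwards [(tendsto_devOf r Z hq).eventually hgrow] with z hz hA hV
    have := hz hA.1 hA.2
    rw [mul_assoc]
    exact mul_le_mul_of_nonneg_left this (by positivity)
  · refine (h.frequently_near hq hr hl e₃ e₄ hb₂ hab).mono ?_
    rintro z ⟨h1, h2, h3⟩
    exact ⟨⟨h1, h2⟩, h3⟩

end IsEquilibriumData

end Chetaev

/-! ### The sign of `det S` and the critical distance -/

section Threshold

open Set

/-- The function whose value `1` determines the stability threshold. -/
def threshold (μ α : ℝ) : ℝ := 2 * Real.sinh α ^ 2 * (√(1 + μ ^ 2 * Real.sinh (2 * α) ^ 2) - 1)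

theorem threshold_strictMonoOn {μ : ℝ} (hμ : 0 < μ) : StrictMonoOn (threshold μ) (Ici 0) := by
  intro a ha b hb hab
  have ha0 : 0 ≤ a := ha
  have hsa : 0 ≤ Real.sinh a := Real.sinh_nonneg_iff.2 ha0
  have hsa2 : 0 ≤ Real.sinh (2 * a) := Real.sinh_nonneg_iff.2 (by linarith)
  have h1 : Real.sinh a < Real.sinh b := Real.sinh_lt_sinh.2 hab
  have h2 : Real.sinh (2 * a) < Real.sinh (2 * b) := Real.sinh_lt_sinh.2 (by linarith)
  have h3 : Real.sinh a ^ 2 < Real.sinh b ^ 2 := pow_lt_pow_left₀ h1 hsa two_ne_zero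
  have h4 : Real.sinh (2 * a) ^ 2 < Real.sinh (2 * b) ^ 2 := pow_lt_pow_left₀ h2 hsa2 two_ne_zero
  have h5 : √(1 + μ ^ 2 * Real.sinh (2 * a) ^ 2) < √(1 + μ ^ 2 * Real.sinh (2 * b) ^ 2) := by
    apply Real.sqrt_lt_sqrt (by positivity)
    gcongr
  have h6 : 1 ≤ √(1 + μ ^ 2 * Real.sinh (2 * a) ^ 2) := by
    rw [Real.one_le_sqrt]
    have : 0 ≤ μ ^ 2 * Real.sinh (2 * a) ^ 2 := by positivity
    linarith
  unfold threshold
  exact mul_lt_mul'' (by linarith) (by linarith) (by positivity) (by linarith)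

theorem exists_threshold_eq_one {μ : ℝ} (hμ : 0 < μ) : ∃ α, 0 < α ∧ threshold μ α = 1 := by
  have hcont : Continuous (threshold μ) := by
    unfold threshold
    have := Real.continuous_sinh
    fun_prop
  -- Large enough for `sinh b ≥ 1` and `μ sinh 2b ≥ 2`, which makes both factors of `threshold`
  -- sufficiently large.
  set b := Real.arsinh 1 + Real.arsinh (2 / μ) with hb
  have h1 : 0 < Real.arsinh 1 := Real.arsinh_pos_iff.2 one_pos
  have h2 : 0 < Real.arsinh (2 / μ) := Real.arsinh_pos_iff.2 (by positivity)
  have h3 : 1 ≤ Real.sinh b := by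
    rw [← Real.sinh_arsinh 1]
    exact Real.sinh_le_sinh.2 (by linarith)
  have h4 : 2 / μ ≤ Real.sinh (2 * b) := by
    rw [← Real.sinh_arsinh (2 / μ)]
    exact Real.sinh_le_sinh.2 (by linarith)
  have h5 : 2 ≤ √(1 + μ ^ 2 * Real.sinh (2 * b) ^ 2) := by
    rw [Real.le_sqrt (by norm_num) (by positivity)]
    have : 2 ≤ μ * Real.sinh (2 * b) := by
      rw [div_le_iff₀ hμ] at h4
      linarith
    nlinarith
  have h6 : 1 ≤ threshold μ b := by
    unfold threshold
    nlinarith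
  obtain ⟨α, hα, he⟩ := intermediate_value_Icc (by linarith : (0 : ℝ) ≤ b) hcont.continuousOn
    (show (1 : ℝ) ∈ Icc (threshold μ 0) (threshold μ b) from ⟨by simp [threshold], h6⟩)
  refine ⟨α, hα.1.lt_of_ne fun h0 => ?_, he⟩
  rw [← h0] at he
  simp [threshold] at he

/-- The distance of the particles as a function of the parameter `α`. -/
def distanceOf (μ α : ℝ) : ℝ := α + 1 / 2 * Real.arsinh (μ * Real.sinh (2 * α))

theorem distanceOf_strictMono {μ : ℝ} (hμ : 0 < μ) : StrictMono (distanceOf μ) := by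
  intro a b hab
  have h1 : Real.sinh (2 * a) < Real.sinh (2 * b) := Real.sinh_lt_sinh.2 (by linarith)
  have h2 : Real.arsinh (μ * Real.sinh (2 * a)) < Real.arsinh (μ * Real.sinh (2 * b)) :=
    Real.arsinh_lt_arsinh.2 (mul_lt_mul_of_pos_left h1 hμ)
  unfold distanceOf
  linarith

theorem exists_tanh_eq {r : ℝ} (h0 : 0 < r) (h1 : r < 1) :
    ∃ α, 0 < α ∧ r = Real.sinh α / Real.cosh α := by
  have hw : 0 < √(1 - r ^ 2) := Real.sqrt_pos.2 (by nlinarith)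
  have hw2 : √(1 - r ^ 2) ^ 2 = 1 - r ^ 2 := Real.sq_sqrt (by nlinarith)
  refine ⟨Real.arsinh (r / √(1 - r ^ 2)), Real.arsinh_pos_iff.2 (by positivity), ?_⟩
  rw [Real.sinh_arsinh, Real.cosh_arsinh]
  have : 1 + (r / √(1 - r ^ 2)) ^ 2 = (1 / √(1 - r ^ 2)) ^ 2 := by
    field_simp
    linarith
  rw [this, Real.sqrt_sq (by positivity)]
  field_simp

theorem det_eq {M r Z c : ℝ} (hr : r ≠ 0) : S₁₁ r Z c * S₂₂ M Z c - S₁₂ M r Z c ^ 2 =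
    Z ^ 4 * (c ^ 2 - 1) ^ 2 * (c / r * M * (1 - r ^ 2) ^ 2 - (2 * M * c * r - 1 - r ^ 2) ^ 2) := by
  unfold S₁₁ S₁₂ S₂₂
  field_simp

namespace IsEquilibriumData

variable {μ g r Z q α : ℝ}

/-- The relation between the distance and the parameter `α`, where `r = tanh α` or
`r = coth α`. -/
theorem sinh_relation (h : IsEquilibriumData (1 + μ) g r Z (coth q)) (hq : 0 < q) (hα : 0 < α)
    (hr : r = Real.sinh α / Real.cosh α ∨ r = Real.cosh α / Real.sinh α) :
    (1 + μ) * (Real.sinh α * Real.cosh α) = Real.sinh q * Real.cosh (q - 2 * α) ∧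
    Real.sinh (2 * q - 2 * α) = μ * Real.sinh (2 * α) := by
  have hs : 0 < Real.sinh q := Real.sinh_pos_iff.2 hq
  have hS : 0 < Real.sinh α := Real.sinh_pos_iff.2 hα
  have hC := Real.cosh_pos α
  have hcs := Real.cosh_sq q
  have hCS := Real.cosh_sq α
  have e0 := h.ratio
  have hD : coth q ^ 2 - 1 = 1 / Real.sinh q ^ 2 := by
    rw [coth, div_pow, hcs]
    field_simp
    ring
  rw [hD, coth] at e0
  have e1 : (1 + μ) * (Real.sinh α * Real.cosh α) = Real.sinh q * Real.cosh (q - 2 * α) := by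
    rw [Real.cosh_sub, Real.sinh_two_mul, Real.cosh_two_mul]
    rcases hr with rfl | rfl
    · field_simp at e0
      linear_combination -e0
    · field_simp at e0
      linear_combination -e0
  refine ⟨e1, ?_⟩
  have e2 : Real.sinh (2 * q - 2 * α) + Real.sinh (2 * α) =
      2 * (Real.sinh q * Real.cosh (q - 2 * α)) := by
    have a := Real.sinh_add q (q - 2 * α)
    have b := Real.sinh_sub q (q - 2 * α)
    rw [show q + (q - 2 * α) = 2 * q - 2 * α by ring] at a
    rw [show q - (q - 2 * α) = 2 * α by ring] at b
    linear_combination a + b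
  rw [← e1] at e2
  have e3 := Real.sinh_two_mul α
  linear_combination e2 + μ * (-1) * e3 + (-1) * e3

/-- With `F = cosh (2q - 2α) = √(1 + μ² sinh² 2α)`, addition formulas reduce the determinant, up to
positive factors, to `F + 1 + 2 sinh² α - 2 sinh² α F²`. This has the root `F = -1`, and the other
factor is `1 - threshold μ α`. -/
theorem det_elliptic (h : IsEquilibriumData (1 + μ) g r Z (coth q)) (hq : 0 < q) (hα : 0 < α)
    (hr : r = Real.sinh α / Real.cosh α) :
    ∃ k > 0, S₁₁ r Z (coth q) * S₂₂ (1 + μ) Z (coth q) - S₁₂ (1 + μ) r Z (coth q) ^ 2 =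
      k * (1 - threshold μ α) := by
  obtain ⟨e1, e2⟩ := h.sinh_relation hq hα (Or.inl hr)
  have hs : 0 < Real.sinh q := Real.sinh_pos_iff.2 hq
  have hS : 0 < Real.sinh α := Real.sinh_pos_iff.2 hα
  have hC := Real.cosh_pos α
  have hCS := Real.cosh_sq α
  have hF : √(1 + μ ^ 2 * Real.sinh (2 * α) ^ 2) = Real.cosh (2 * q - 2 * α) := by
    rw [← mul_pow, ← e2, add_comm, ← Real.cosh_sq, Real.sqrt_sq (Real.cosh_pos _).le]
  have e3 : 2 * (Real.cosh q * Real.cosh (q - 2 * α)) =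
      Real.cosh (2 * q - 2 * α) + Real.cosh (2 * α) := by
    have a := Real.cosh_add q (q - 2 * α)
    have b := Real.cosh_sub q (q - 2 * α)
    rw [show q + (q - 2 * α) = 2 * q - 2 * α by ring] at a
    rw [show q - (q - 2 * α) = 2 * α by ring] at b
    linear_combination -a - b
  have e4 : Real.cosh (2 * α) = 1 + 2 * Real.sinh α ^ 2 := by rw [Real.cosh_two_mul, hCS]; ring
  have hFpos := Real.cosh_pos (2 * q - 2 * α)
  rw [det_eq h.r_pos.ne']
  refine ⟨Z ^ 4 * (coth q ^ 2 - 1) ^ 2 * ((Real.cosh (2 * q - 2 * α) + 1) /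
    (2 * Real.sinh α ^ 2 * Real.cosh α ^ 4)), ?_, ?_⟩
  · have := h.D_pos
    have := h.Z_ne
    positivity
  have hT : threshold μ α = 2 * Real.sinh α ^ 2 * (Real.cosh (2 * q - 2 * α) - 1) := by
    rw [← hF, threshold]
  rw [hT]
  have hM : 1 + μ = Real.sinh q * Real.cosh (q - 2 * α) / (Real.sinh α * Real.cosh α) := by
    rw [← e1]; field_simp
  have t1 : coth q / r * (1 + μ) * (1 - r ^ 2) ^ 2 =
      Real.cosh q * Real.cosh (q - 2 * α) / (Real.sinh α ^ 2 * Real.cosh α ^ 4) := by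
    have : 1 - r ^ 2 = 1 / Real.cosh α ^ 2 := by
      rw [hr, div_pow, hCS]; field_simp; ring
    rw [this, hM, hr, coth]
    field_simp
  have t2 : 2 * (1 + μ) * coth q * r - 1 - r ^ 2 = Real.cosh (2 * q - 2 * α) / Real.cosh α ^ 2 := by
    have : 2 * (1 + μ) * coth q * r = 2 * (Real.cosh q * Real.cosh (q - 2 * α)) /
        Real.cosh α ^ 2 := by
      rw [hM, hr, coth]; field_simp
    rw [this, e3, e4, hr]
    field_simp
    rw [hCS]
    ring
  rw [t1, t2]
  have e5 : Real.cosh q * Real.cosh (q - 2 * α) =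
      (Real.cosh (2 * q - 2 * α) + (1 + 2 * Real.sinh α ^ 2)) / 2 := by
    rw [← e4, ← e3]; ring
  rw [e5]
  generalize Real.cosh (2 * q - 2 * α) = F
  have key : (F + (1 + 2 * Real.sinh α ^ 2)) / 2 / (Real.sinh α ^ 2 * Real.cosh α ^ 4) -
      (F / Real.cosh α ^ 2) ^ 2 = (F + 1) / (2 * Real.sinh α ^ 2 * Real.cosh α ^ 4) *
        (1 - 2 * Real.sinh α ^ 2 * (F - 1)) := by
    field_simp
    ring
  rw [key, ← mul_assoc]

/-- Exchanging `sinh α` and `cosh α` in the elliptic computation moves the root to `F = 1`, and the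
determinant is negative because `F = cosh (2q - 2α) > 1`. -/
theorem det_hyperbolic (h : IsEquilibriumData (1 + μ) g r Z (coth q)) (hμ : 0 < μ) (hq : 0 < q)
    (hα : 0 < α) (hr : r = Real.cosh α / Real.sinh α) :
    S₁₁ r Z (coth q) * S₂₂ (1 + μ) Z (coth q) < S₁₂ (1 + μ) r Z (coth q) ^ 2 := by
  obtain ⟨e1, e2⟩ := h.sinh_relation hq hα (Or.inr hr)
  have hs : 0 < Real.sinh q := Real.sinh_pos_iff.2 hq
  have hS : 0 < Real.sinh α := Real.sinh_pos_iff.2 hα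
  have hC := Real.cosh_pos α
  have hCS := Real.cosh_sq α
  have e3 : 2 * (Real.cosh q * Real.cosh (q - 2 * α)) =
      Real.cosh (2 * q - 2 * α) + Real.cosh (2 * α) := by
    have a := Real.cosh_add q (q - 2 * α)
    have b := Real.cosh_sub q (q - 2 * α)
    rw [show q + (q - 2 * α) = 2 * q - 2 * α by ring] at a
    rw [show q - (q - 2 * α) = 2 * α by ring] at b
    linear_combination -a - b
  have e4 : Real.cosh (2 * α) = 2 * Real.cosh α ^ 2 - 1 := by rw [Real.cosh_two_mul, hCS]; ring
  have hF1 : 1 < Real.cosh (2 * q - 2 * α) := by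
    rw [Real.one_lt_cosh]
    intro h0
    rw [h0, Real.sinh_zero] at e2
    have : 0 < Real.sinh (2 * α) := Real.sinh_pos_iff.2 (by linarith)
    have := mul_pos hμ this
    linarith
  have hM : 1 + μ = Real.sinh q * Real.cosh (q - 2 * α) / (Real.sinh α * Real.cosh α) := by
    rw [← e1]; field_simp
  have t1 : coth q / r * (1 + μ) * (1 - r ^ 2) ^ 2 =
      Real.cosh q * Real.cosh (q - 2 * α) / (Real.cosh α ^ 2 * Real.sinh α ^ 4) := by
    have : 1 - r ^ 2 = -(1 / Real.sinh α ^ 2) := by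
      rw [hr, div_pow, hCS]; field_simp; ring
    rw [this, hM, hr, coth]
    field_simp
  have t2 : 2 * (1 + μ) * coth q * r - 1 - r ^ 2 = Real.cosh (2 * q - 2 * α) / Real.sinh α ^ 2 := by
    have : 2 * (1 + μ) * coth q * r = 2 * (Real.cosh q * Real.cosh (q - 2 * α)) /
        Real.sinh α ^ 2 := by
      rw [hM, hr, coth]; field_simp
    rw [this, e3, e4, hr]
    field_simp
    rw [hCS]
    ring
  have e5 : Real.cosh q * Real.cosh (q - 2 * α) =
      (Real.cosh (2 * q - 2 * α) + (2 * Real.cosh α ^ 2 - 1)) / 2 := by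
    rw [← e4, ← e3]; ring
  rw [← sub_neg, det_eq h.r_pos.ne', t1, t2, e5]
  generalize Real.cosh (2 * q - 2 * α) = F at *
  refine mul_neg_of_pos_of_neg ?_ ?_
  · have := h.D_pos
    have := h.Z_ne
    positivity
  have t3 : (F + (2 * Real.cosh α ^ 2 - 1)) / 2 / (Real.cosh α ^ 2 * Real.sinh α ^ 4) -
      (F / Real.sinh α ^ 2) ^ 2 = -((F - 1) * (2 * Real.cosh α ^ 2 * (F + 1) - 1) /
        (2 * Real.cosh α ^ 2 * Real.sinh α ^ 4)) := by
    field_simp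
    ring
  rw [t3, neg_lt_zero]
  have t4 : 0 < F - 1 := by linarith
  have t5 : 0 < 2 * Real.cosh α ^ 2 * (F + 1) - 1 := by
    have : 1 ≤ Real.cosh α ^ 2 := by rw [hCS]; nlinarith [sq_nonneg (Real.sinh α)]
    nlinarith
  positivity

end IsEquilibriumData

end Threshold

end LobachevskyTwoBody

end
-- The stability theorem
theorem mainTheorem3 (G μ₁ μ₂ : ℝ) (hG : 0 < G) (hμ₁ : 0 < μ₁) (hμ₂ : 0 < μ₂) :
    -- hyperbolic relative equilibria
    (∀ (ξ : Matrix (Fin 3) (Fin 3) ℝ) (R₁ R₂ : ℝ → Vec) (t : ℝ) (z : RedVec),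
      IsRelativeEquilibrium μ₁ μ₂ (gravPotential G μ₁ μ₂) ξ R₁ R₂ → IsHyperbolic ξ →
      IsReducedState μ₁ μ₂ (R₁ t) (R₂ t) (deriv R₁ t) (deriv R₂ t) z →
      IsLinearlyUnstable (redField μ₁ μ₂ (gravPotential G μ₁ μ₂)) redSpace z ∧
      IsLyapunovUnstableWithin (redField μ₁ μ₂ (gravPotential G μ₁ μ₂)) redSpace
        {w | casimir w = casimir z} z) ∧
    -- elliptic relative equilibria
    ∃ αs qs : ℝ,
      (∀ α : ℝ, (0 < α ∧ 2 * Real.sinh α ^ 2 + 1 =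
          2 * Real.sinh α ^ 2 * √(1 + (μ₁ / μ₂) ^ 2 * Real.sinh (2 * α) ^ 2)) ↔ α = αs) ∧
      qs = αs + 1 / 2 * Real.arsinh (μ₁ / μ₂ * Real.sinh (2 * αs)) ∧
      0 < qs ∧
      ∀ (ξ : Matrix (Fin 3) (Fin 3) ℝ) (R₁ R₂ : ℝ → Vec) (t : ℝ) (z : RedVec),
        IsRelativeEquilibrium μ₁ μ₂ (gravPotential G μ₁ μ₂) ξ R₁ R₂ → IsElliptic ξ →
        IsReducedState μ₁ μ₂ (R₁ t) (R₂ t) (deriv R₁ t) (deriv R₂ t) z →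
        (hdist (R₁ t) (R₂ t) < qs →
          IsLyapunovStable (redField μ₁ μ₂ (gravPotential G μ₁ μ₂)) redSpace z) ∧
        (qs < hdist (R₁ t) (R₂ t) →
          IsLinearlyUnstable (redField μ₁ μ₂ (gravPotential G μ₁ μ₂)) redSpace z ∧
          IsLyapunovUnstableWithin (redField μ₁ μ₂ (gravPotential G μ₁ μ₂)) redSpace
            {w | casimir w = casimir z} z) := by
  have hX : ∀ z ∈ redSpace, redField μ₁ μ₂ (gravPotential G μ₁ μ₂) z =
      polyField (1 + μ₁ / μ₂) (G * μ₁ ^ 2 * μ₂) μ₁ z := fun z hz => redField_eq G hμ₁.ne' hz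
  have hXd : ∀ z ∈ redSpace, ContDiffAt ℝ 1 (redField μ₁ μ₂ (gravPotential G μ₁ μ₂)) z :=
    fun z hz => contDiffAt_redField G hμ₁.ne' hz
  have hμ : 0 < μ₁ / μ₂ := div_pos hμ₁ hμ₂
  refine ⟨fun ξ R₁ R₂ t z hre hhyp hz => ?_, ?_⟩
  · obtain ⟨-, hq, r, Z, hze, hdata, -, hr⟩ := hre.exists_equilibriumData hG hμ₁ hμ₂ hz
    have hr1 := hr hhyp
    -- For `r > 1` it is `1 / r` that is a hyperbolic tangent, so `r = coth α`.
    obtain ⟨α, hα, hrα⟩ := exists_tanh_eq (inv_pos.2 hdata.r_pos) (inv_lt_one_of_one_lt₀ hr1)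
    have hrα' : r = Real.cosh α / Real.sinh α := by
      rw [← inv_inv r, hrα, inv_div]
    have := hdata.isUnstable hq (by nlinarith) hμ₁ hX hXd
      (hdata.det_hyperbolic hμ hq hα hrα')
    rw [hze]
    exact this
  · obtain ⟨αs, hαs, hthr⟩ := exists_threshold_eq_one hμ
    have hmono := threshold_strictMonoOn hμ
    refine ⟨αs, distanceOf (μ₁ / μ₂) αs, fun α => ?_, rfl, ?_, fun ξ R₁ R₂ t z hre hell hz => ?_⟩
    · have heq : 2 * Real.sinh α ^ 2 + 1 =
          2 * Real.sinh α ^ 2 * √(1 + (μ₁ / μ₂) ^ 2 * Real.sinh (2 * α) ^ 2) ↔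
          threshold (μ₁ / μ₂) α = 1 := by
        unfold threshold
        constructor <;> intro h <;> linarith
      rw [heq]
      constructor
      · rintro ⟨hα, h⟩
        exact hmono.injOn hα.le hαs.le (h.trans hthr.symm)
      · rintro rfl
        exact ⟨hαs, hthr⟩
    · have := distanceOf_strictMono hμ hαs
      simpa [distanceOf] using this
    · obtain ⟨hd, hq, r, Z, hze, hdata, hr, -⟩ := hre.exists_equilibriumData hG hμ₁ hμ₂ hz
      have hr1 := hr hell
      have hr0 := hdata.r_pos
      obtain ⟨α, hα, hrα⟩ := exists_tanh_eq hr0 hr1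
      obtain ⟨k, hk, hdet⟩ := hdata.det_elliptic hq hα hrα
      -- The distance is an increasing function of `α`, so comparing it with the critical distance
      -- amounts to comparing `α` with `αs`, and hence `threshold` with `1`.
      have hqα : z.2.1 = distanceOf (μ₁ / μ₂) α := by
        rw [distanceOf, ← (hdata.sinh_relation hq hα (Or.inl hrα)).2, Real.arsinh_sinh]
        ring
      rw [hd, hze]
      simp only
      rw [hqα] at hdata hdet hq ⊢
      constructor
      · intro hlt
        have h1 := hmono hα.le hαs.le ((distanceOf_strictMono hμ).lt_iff_lt.1 hlt)
        have h2 := mul_pos hk (by linarith : 0 < 1 - threshold (μ₁ / μ₂) α)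
        exact hdata.isLyapunovStable hq (by nlinarith) hX hXd (by linarith)
      · intro hlt
        have h1 := hmono hαs.le hα.le ((distanceOf_strictMono hμ).lt_iff_lt.1 hlt)
        have h2 := mul_pos hk (by linarith : 0 < threshold (μ₁ / μ₂) α - 1)
        exact hdata.isUnstable hq (by nlinarith) hμ₁ hX hXd (by linarith)
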